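/- Let $V_3$ be the $18$-dimensional complex vector space of quadratic homogeneous vector fields $X=\sum_{i=1}^3 P_i(z_1,z_2,z_3)\,\partial/\partial z_i$ on $\mathbb{C}^3$. A radial orbit of $X$ is a line through the origin of $\mathbb{C}^3$ that is invariant by $X$; it is nondegenerate if $X$ does not vanish on it outside the origin, and $X$ is nondegenerate if all its radial orbits are. A nondegenerate radial orbit contains a unique point $a\neq 0$ with $P_i(a)=a_i$ for all $i$; its Kowalevski exponents are the two roots (with multiplicity) of $\det\big([\mathbb{I}-M]-\lambda\mathbb{I}\big)/(\lambda+1)$, where $M=\big(\partial P_i/\partial z_j(a)\big)_{i,j}$. Let $\Psi\colon V_3\dashrightarrow \mathrm{Sym}^7\big(\mathrm{Sym}^2(\mathbb{C})\big)$ be the partial map, defined on the set of nondegenerate vector fields having exactly seven radial orbits, that associates to a vector field the unordered collection (with repetitions) of the seven unordered pairs of Kowalevski exponents of its radial orbits. Then $\Psi$ is generically defined and, up to linear equivalence, has finite generic fibers: there is a nonempty Zariski-open subset $U\subset V_3$ such that every $X\in U$ is in the domain of $\Psi$ and the vector fields $Y$ in the domain of $\Psi$ with $\Psi(Y)=\Psi(X)$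 belong to finitely many classes of linear equivalence (where $X$ and $Y$ are linearly equivalent if some invertible linear change of coordinates of $\mathbb{C}^3$ maps one to the other). -/

import Mathlib

noncomputable section

/-- The space `V_n` of quadratic homogeneous vector fields `∑ P_i ∂/∂z_i` on `ℂ^n`, a vector field
being given by its components `P_i`. -/
abbrev QuadVF (n : ℕ) : Type :=
  Fin n → MvPolynomial.homogeneousSubmodule (Fin n) ℂ 2

namespace QuadVF

variable {n : ℕ}

/-- The value at the point `z` of the vector field `X`. -/
def value (X : QuadVF n) (z : Fin n → ℂ) : Fin n → ℂ :=
  fun i => MvPolynomial.eval z (X i : MvPolynomial (Fin n) ℂ)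

/-- The matrix `M_ij = ∂P_i/∂z_j (a)`. -/
def jacobian (X : QuadVF n) (a : Fin n → ℂ) : Matrix (Fin n) (Fin n) ℂ :=
  Matrix.of fun i j =>
    MvPolynomial.eval a (MvPolynomial.pderiv j (X i : MvPolynomial (Fin n) ℂ))

/-- The radial orbits of `X`: the lines through the origin of `ℂ^n` that are invariant by `X`. -/
def RadialOrbit (X : QuadVF n) : Type :=
  {ρ : Projectivization ℂ (Fin n → ℂ) // ∀ z ∈ ρ.submodule, X.value z ∈ ρ.submodule}

/-- A radial orbit is nondegenerate if `X` vanishes at none of its points but the origin. -/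
def RadialOrbit.IsNondegenerate {X : QuadVF n} (ρ : X.RadialOrbit) : Prop :=
  ∀ z ∈ ρ.1.submodule, z ≠ 0 → X.value z ≠ 0

/-- A vector field is nondegenerate if all its radial orbits are. -/
def IsNondegenerate (X : QuadVF n) : Prop :=
  ∀ ρ : X.RadialOrbit, ρ.IsNondegenerate

theorem value_smul (X : QuadVF n) (c : ℂ) (z : Fin n → ℂ) :
    X.value (c • z) = c ^ 2 • X.value z := by
  funext i
  have h : (X i : MvPolynomial (Fin n) ℂ).IsHomogeneous 2 := (X i).2
  simp only [value, Pi.smul_apply, smul_eq_mul, MvPolynomial.eval_eq, Finset.mul_sum]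
  refine Finset.sum_congr rfl fun d hd => ?_
  have hdeg : ∑ j ∈ d.support, d j = 2 := by
    have := h (MvPolynomial.mem_support_iff.mp hd)
    simpa [Finsupp.weight_apply, Finsupp.sum] using this
  simp only [mul_pow, Finset.prod_mul_distrib,
    Finset.prod_pow_eq_pow_sum, hdeg]
  ring

/-- A nondegenerate radial orbit contains exactly one point `a ≠ 0` with `P_i(a) = a_i`. -/
theorem RadialOrbit.IsNondegenerate.existsUnique {X : QuadVF n} {ρ : X.RadialOrbit}
    (hρ : ρ.IsNondegenerate) :
    ∃! a : Fin n → ℂ, a ∈ ρ.1.submodule ∧ a ≠ 0 ∧ X.value a = a := by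
  have hz : ρ.1.rep ∈ ρ.1.submodule := by
    rw [Projectivization.submodule_eq]; exact Submodule.mem_span_singleton_self _
  have hz0 : ρ.1.rep ≠ 0 := ρ.1.rep_nonzero
  have hmem : ∀ w ∈ ρ.1.submodule, ∃ c : ℂ, c • ρ.1.rep = w := fun w hw => by
    rw [Projectivization.submodule_eq] at hw; exact Submodule.mem_span_singleton.mp hw
  obtain ⟨c, hc⟩ := hmem _ (ρ.2 _ hz)
  have hc0 : c ≠ 0 := by
    rintro rfl
    exact hρ _ hz hz0 (by rw [← hc, zero_smul])
  refine ⟨c⁻¹ • ρ.1.rep, ⟨Submodule.smul_mem _ _ hz, smul_ne_zero (inv_ne_zero hc0) hz0, ?_⟩, ?_⟩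
  · rw [value_smul, ← hc, smul_smul]
    congr 1
    field_simp
  · rintro b ⟨hb, hb0, hbb⟩
    obtain ⟨d, rfl⟩ := hmem b hb
    have hd0 : d ≠ 0 := by rintro rfl; simp at hb0
    rw [value_smul, ← hc, smul_smul] at hbb
    have h1 : d ^ 2 * c = d := smul_left_injective ℂ hz0 hbb
    have h2 : d * c = 1 := by
      apply mul_left_cancel₀ hd0
      linear_combination h1
    rw [eq_inv_of_mul_eq_one_left h2]

/-- The point `a ≠ 0` of a nondegenerate radial orbit at which `P_i(a) = a_i`. -/
def RadialOrbit.point {X : QuadVF n} (ρ : X.RadialOrbit) (hρ : ρ.IsNondegenerate) : Fin n → ℂ :=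
  hρ.existsUnique.choose

/-- The Kowalevski exponents of a nondegenerate radial orbit: the roots, with multiplicity, of the
characteristic polynomial of `I - M` divided by `λ + 1`, for `M` the Jacobian matrix at the
point `a` of the orbit with `P_i(a) = a_i`. -/
def RadialOrbit.exponents {X : QuadVF n} (ρ : X.RadialOrbit) (hρ : ρ.IsNondegenerate) :
    Multiset ℂ :=
  ((1 - X.jacobian (ρ.point hρ)).charpoly /ₘ (Polynomial.X - Polynomial.C (-1))).roots

theorem RadialOrbit.card_exponents {X : QuadVF 3} (ρ : X.RadialOrbit) (hρ : ρ.IsNondegenerate) :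
    (ρ.exponents hρ).card = 2 := by
  unfold RadialOrbit.exponents
  rw [← (IsAlgClosed.splits _).natDegree_eq_card_roots,
    Polynomial.natDegree_divByMonic _ (Polynomial.monic_X_sub_C _),
    Matrix.charpoly_natDegree_eq_dim, Polynomial.natDegree_X_sub_C, Fintype.card_fin]

/-- The two exponents of a nondegenerate radial orbit on `ℂ^3`, as an unordered pair. -/
def RadialOrbit.exponentPair {X : QuadVF 3} (ρ : X.RadialOrbit) (hρ : ρ.IsNondegenerate) :
    Sym ℂ 2 :=
  ⟨ρ.exponents hρ, ρ.card_exponents hρ⟩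

/-- The exponents of the radial orbits of a nondegenerate vector field on `ℂ^3` having exactly
seven of them, as an unordered set (with repetitions) of seven unordered pairs. -/
def allExponents (X : QuadVF 3) (hX : X.IsNondegenerate) (h7 : Nat.card X.RadialOrbit = 7) :
    Sym (Sym ℂ 2) 7 :=
  haveI : Finite X.RadialOrbit := Nat.finite_of_card_ne_zero (by omega)
  letI : Fintype X.RadialOrbit := Fintype.ofFinite _
  Sym.mk ((Finset.univ : Finset X.RadialOrbit).val.map fun ρ => ρ.exponentPair (hX ρ))
    ((Multiset.card_map _ _).trans
      ((Nat.card_eq_fintype_card (α := X.RadialOrbit)).symm.trans h7))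

/-- The map `Ψ : V_3 ⇢ Sym^7(Sym^2(ℂ))`, defined on the nondegenerate vector fields having exactly
seven radial orbits. -/
def Psi : QuadVF 3 →. Sym (Sym ℂ 2) 7 := fun X =>
  ⟨X.IsNondegenerate ∧ Nat.card X.RadialOrbit = 7, fun h => X.allExponents h.1 h.2⟩

/-- Linear equivalence: an invertible linear change of coordinates maps `X` to `Y`. -/
def LinearlyEquivalent (X Y : QuadVF n) : Prop :=
  ∃ g : (Fin n → ℂ) ≃ₗ[ℂ] (Fin n → ℂ), ∀ z, Y.value (g z) = g (X.value z)

/-- The coefficients of the components of `X`, linear coordinates on `V_n`. -/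
def coeffs (X : QuadVF n) : Fin n × (Fin n →₀ ℕ) → ℂ :=
  fun q => MvPolynomial.coeff q.2 (X q.1 : MvPolynomial (Fin n) ℂ)

/-- The property `p` holds for a generic vector field: it holds on a nonempty Zariski-open subset
of `V_n`, that is, wherever some polynomial in the coefficients that is not identically zero on
`V_n` does not vanish. -/
def Generically (p : QuadVF n → Prop) : Prop :=
  ∃ F : MvPolynomial (Fin n × (Fin n →₀ ℕ)) ℂ,
    (∃ X : QuadVF n, MvPolynomial.eval X.coeffs F ≠ 0) ∧
      ∀ X : QuadVF n, MvPolynomial.eval X.coeffs F ≠ 0 → p X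

end QuadVF

end

/-!
Radial orbits of a nondegenerate field `X` are the nonzero fixed points of the quadratic map
`z ↦ X(z)`, and the exponents at a fixed point amount to the trace of `M` and the determinant of
`I - M` there. A generic field has seven fixed points, all of them simple, and no six of them lie
on a conic, so that the field is determined by any six of its fixed points. A linear change of
coordinates moves three of them to prescribed positions. It remains to see that, on the variety of
configurations of six points whose first three points are prescribed, the six traces and three of
the determinants have finite generic fibers. This is a matter of tangent vectors at a single
configuration, chosen explicitly: none but zero is annihilated by the differentials of the nine
functions, hence these functions together with the first three points generate a ring over which
the ring of all regular functions is algebraic.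
-/

section Specialization

variable {k A : Type*} [Field k] [IsAlgClosed k] [CommRing A] [Algebra k A]

theorem exists_algHom_extension_of_comap_eq_ker {B : Type*} [CommRing B] [Algebra k B]
    [Algebra A B] [IsScalarTower k A B] [Algebra.FiniteType k B] (φ : A →ₐ[k] k)
    (q : PrimeSpectrum B) (hq : q.asIdeal.comap (algebraMap A B) = RingHom.ker φ) :
    ∃ χ : B →ₐ[k] k, ∀ a, χ (algebraMap A B a) = φ a := by
  obtain ⟨N, hN, hqN⟩ := Ideal.exists_le_maximal q.asIdeal q.2.ne_top
  let : Field (B ⧸ N) := Ideal.Quotient.field N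
  have : Module.Finite k (B ⧸ N) := finite_of_finite_type_of_isJacobsonRing k (B ⧸ N)
  let e : k ≃ₐ[k] (B ⧸ N) := AlgEquiv.ofBijective (Algebra.ofId k (B ⧸ N))
    IsAlgClosed.algebraMap_bijective_of_isIntegral
  refine ⟨e.symm.toAlgHom.comp (Ideal.Quotient.mkₐ k N), fun a => ?_⟩
  have hmem : algebraMap A B (a - algebraMap k A (φ a)) ∈ N := by
    apply hqN
    rw [← Ideal.mem_comap, hq, RingHom.mem_ker, map_sub, φ.commutes]
    exact sub_self _
  rw [map_sub, ← IsScalarTower.algebraMap_apply, ← Ideal.Quotient.eq] at hmem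
  exact (congrArg e.symm hmem).trans (e.symm.commutes _)

theorem exists_forall_exists_algHom_extension_of_flat {B : Type*} [CommRing B] [Algebra k B]
    [Algebra A B] [IsScalarTower k A B] [Algebra.FiniteType k A] [Algebra.FinitePresentation A B]
    [Module.Flat A B] (χ₀ : B →ₐ[k] k) :
    ∃ F : A, χ₀ (algebraMap A B F) ≠ 0 ∧ ∀ φ : A →ₐ[k] k, φ F ≠ 0 →
      ∃ χ : B →ₐ[k] k, ∀ a, χ (algebraMap A B a) = φ a := by
  have : Algebra.FiniteType k B := Algebra.FiniteType.trans (S := A) inferInstance inferInstance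
  have hopen := (PrimeSpectrum.isOpenMap_comap_of_hasGoingDown_of_finitePresentation
    (R := A) (S := B)).isOpen_range
  let q₀ : PrimeSpectrum B := ⟨RingHom.ker χ₀, RingHom.ker_isPrime _⟩
  obtain ⟨_, ⟨F, rfl⟩, hxF, hF⟩ :=
    PrimeSpectrum.isTopologicalBasis_basic_opens.exists_subset_of_mem_open
      (Set.mem_range_self q₀) hopen
  refine ⟨F, hxF, fun φ hφ => ?_⟩
  obtain ⟨q, hq⟩ := hF (show (⟨RingHom.ker φ, RingHom.ker_isPrime _⟩ : PrimeSpectrum A) ∈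
    (PrimeSpectrum.basicOpen F : Set _) from hφ)
  exact exists_algHom_extension_of_comap_eq_ker φ q (congrArg PrimeSpectrum.asIdeal hq)

end Specialization

section SquareSystem

open MvPolynomial

variable {A σ : Type*} [CommRing A] [Fintype σ] [DecidableEq σ]
  (H : σ → MvPolynomial σ A) (G : MvPolynomial σ A)

/-- The coordinate ring of the scheme over `A` of those zeros of the square system `H` at which
neither `G` nor the Jacobian determinant of `H` vanishes. -/
abbrev NondegenerateZeros : Type _ :=
  Localization.Away (Ideal.Quotient.mk (Ideal.span (Set.range H))
    ((Matrix.of fun i j => pderiv i (H j)).det * G))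

instance : Algebra.IsStandardSmooth A (NondegenerateZeros H G) := by
  let I : Ideal (MvPolynomial σ A) := Ideal.span (Set.range H)
  let J : MvPolynomial σ A := (Matrix.of fun i j => pderiv i (H j)).det
  let g := Ideal.Quotient.mk I (J * G)
  let P : Algebra.PreSubmersivePresentation A (MvPolynomial σ A ⧸ I) σ σ :=
    Algebra.PreSubmersivePresentation.naive id Function.injective_id
  let Q := Algebra.PreSubmersivePresentation.localizationAway (Localization.Away g) g
  have hval : (aeval P.val : MvPolynomial σ A →ₐ[A] _) = Ideal.Quotient.mkₐ A I := by
    ext i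
    exact aeval_X P.val i
  have hPJ : P.jacobian = Ideal.Quotient.mk I J := by
    have hmat : P.jacobiMatrix = Matrix.of fun i j => pderiv i (H j) := by
      ext1 i j
      exact Algebra.PreSubmersivePresentation.jacobiMatrix_naive _ _ _ _ _ _
    rw [Algebra.PreSubmersivePresentation.jacobian_eq_jacobiMatrix_det, hmat, P.algebraMap_eq]
    exact DFunLike.congr_fun hval J
  have hg : IsUnit (algebraMap _ (Localization.Away g) (Ideal.Quotient.mk I (J * G))) :=
    IsLocalization.Away.algebraMap_isUnit g
  have hJ : IsUnit (algebraMap _ (Localization.Away g) (Ideal.Quotient.mk I J)) := by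
    rw [map_mul, map_mul] at hg
    exact isUnit_of_mul_isUnit_left hg
  have hunit : IsUnit (Q.comp P).jacobian := by
    rw [Algebra.PreSubmersivePresentation.comp_jacobian_eq_jacobian_smul_jacobian,
      Algebra.PreSubmersivePresentation.localizationAway_jacobian, Algebra.smul_def, hPJ]
    exact hJ.mul hg
  exact (Algebra.SubmersivePresentation.mk (Q.comp P) hunit).isStandardSmooth

namespace NondegenerateZeros

variable {H G}

theorem exists_algHom {k : Type*} [Field k] [Algebra k A] (φ : A →ₐ[k] k) (y : σ → k)
    (hH : ∀ i, eval₂ (φ : A →+* k) y (H i) = 0) (hG : eval₂ (φ : A →+* k) y G ≠ 0)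
    (hJ : (Matrix.of fun i j => eval₂ (φ : A →+* k) y (pderiv i (H j))).det ≠ 0) :
    ∃ χ : NondegenerateZeros H G →ₐ[k] k, ∀ a, χ (algebraMap A _ a) = φ a := by
  let e : MvPolynomial σ A →ₐ[k] k := ⟨eval₂Hom (φ : A →+* k) y, fun c =>
    (eval₂Hom_C _ _ _).trans (φ.commutes c)⟩
  have hJ' : e (Matrix.of fun i j => pderiv i (H j)).det ≠ 0 := by
    rw [AlgHom.map_det]
    exact hJ
  let ψ : (MvPolynomial σ A ⧸ Ideal.span (Set.range H)) →ₐ[k] k :=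
    Ideal.Quotient.liftₐ _ e fun a ha =>
      (Ideal.span_le (I := RingHom.ker e)).2 (Set.range_subset_iff.2 hH) ha
  let g := Ideal.Quotient.mk (Ideal.span (Set.range H))
    ((Matrix.of fun i j => pderiv i (H j)).det * G)
  have hg : IsUnit (ψ g) := by
    change IsUnit (e (_ * G))
    rw [map_mul]
    exact (mul_ne_zero hJ' hG).isUnit
  have hψ : ∀ s : Submonoid.powers g, IsUnit (ψ s) := by
    rintro ⟨_, n, rfl⟩
    exact (map_pow ψ g n).symm ▸ hg.pow n
  refine ⟨IsLocalization.liftAlgHom hψ, fun a => ?_⟩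
  rw [IsScalarTower.algebraMap_apply A (MvPolynomial σ A ⧸ Ideal.span (Set.range H)),
    IsLocalization.liftAlgHom_apply]
  exact (IsLocalization.lift_eq _ _).trans (eval₂Hom_C _ _ _)

theorem exists_zero {K : Type*} [Field K] (χ : NondegenerateZeros H G →+* K) :
    ∃ y : σ → K, (∀ i, eval₂ (χ.comp (algebraMap A _)) y (H i) = 0) ∧
      eval₂ (χ.comp (algebraMap A _)) y G ≠ 0 := by
  let B := NondegenerateZeros H G
  let μ : MvPolynomial σ A →+* K := χ.comp (algebraMap _ B)
  have hμ : eval₂Hom (χ.comp (algebraMap A B)) (fun i => μ (X i)) = μ :=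
    ringHom_ext (fun a => by
      rw [eval₂Hom_C]
      exact congrArg χ (IsScalarTower.algebraMap_apply A (MvPolynomial σ A) B a))
      (fun i => eval₂Hom_X' _ _ _)
  have hunit : IsUnit (μ ((Matrix.of fun i j => pderiv i (H j)).det * G)) :=
    (IsLocalization.Away.algebraMap_isUnit (S := B) (Ideal.Quotient.mk (Ideal.span (Set.range H))
      ((Matrix.of fun i j => pderiv i (H j)).det * G))).map χ
  refine ⟨fun i => μ (X i), fun i => (DFunLike.congr_fun hμ (H i)).trans ?_, fun h => ?_⟩
  · have : Ideal.Quotient.mk (Ideal.span (Set.range H)) (H i) = 0 :=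
      Ideal.Quotient.eq_zero_iff_mem.2 (Ideal.subset_span ⟨i, rfl⟩)
    change χ (algebraMap _ B (Ideal.Quotient.mk (Ideal.span (Set.range H)) (H i))) = 0
    rw [this, map_zero, map_zero]
  · rw [map_mul] at hunit
    exact (isUnit_of_mul_isUnit_right hunit).ne_zero ((DFunLike.congr_fun hμ G).symm.trans h)

end NondegenerateZeros

/-- A nondegenerate zero of a square system persists when the parameters vary: the scheme of
nondegenerate zeros is smooth over the parameter space, so its image there is open. -/
theorem exists_forall_exists_zero {k : Type*} [Field k] [IsAlgClosed k] [Algebra k A]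
    [Algebra.FiniteType k A] (φ₀ : A →ₐ[k] k) (y₀ : σ → k)
    (hH : ∀ i, eval₂ (φ₀ : A →+* k) y₀ (H i) = 0) (hG : eval₂ (φ₀ : A →+* k) y₀ G ≠ 0)
    (hJ : (Matrix.of fun i j => eval₂ (φ₀ : A →+* k) y₀ (pderiv i (H j))).det ≠ 0) :
    ∃ F : A, φ₀ F ≠ 0 ∧ ∀ φ : A →ₐ[k] k, φ F ≠ 0 →
      ∃ y : σ → k, (∀ i, eval₂ (φ : A →+* k) y (H i) = 0) ∧ eval₂ (φ : A →+* k) y G ≠ 0 := by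
  obtain ⟨χ₀, hχ₀⟩ := NondegenerateZeros.exists_algHom φ₀ y₀ hH hG hJ
  obtain ⟨F, hF₀, hF⟩ := exists_forall_exists_algHom_extension_of_flat (A := A) χ₀
  refine ⟨F, hχ₀ F ▸ hF₀, fun φ hφ => ?_⟩
  obtain ⟨χ, hχ⟩ := hF φ hφ
  obtain ⟨y, hy⟩ := NondegenerateZeros.exists_zero (χ : NondegenerateZeros H G →+* k)
  have : (χ : NondegenerateZeros H G →+* k).comp (algebraMap A _) = φ := RingHom.ext hχ
  exact ⟨y, this ▸ hy⟩

end SquareSystem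

section UnramifiedPoint

open TensorProduct in
theorem exists_algebraMap_ne_zero_smul_eq_zero {R M F : Type*} [CommRing R] [AddCommGroup M]
    [Module R M] [Module.Finite R M] [Field F] [Algebra R F] (h : ∀ f : M →ₗ[R] F, f = 0)
    (m : M) : ∃ r : R, algebraMap R F r ≠ 0 ∧ r • m = 0 := by
  let p : Ideal R := RingHom.ker (algebraMap R F)
  have : p.IsPrime := RingHom.ker_isPrime _
  suffices ⟨p, this⟩ ∉ Module.support R M from Module.notMem_support_iff'.1 this m
  rw [Module.mem_support_iff_nontrivial_residueField_tensorProduct, not_nontrivial_iff_subsingleton]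
  let κ := p.ResidueField
  let ι : κ →ₐ[R] F := Ideal.ResidueField.liftₐ p (Algebra.ofId R F) le_rfl
    fun _ hr => IsUnit.mk0 _ hr
  refine subsingleton_of_forall_eq 0 fun v =>
    (Module.forall_dual_apply_eq_zero_iff κ v).1 fun f => ?_
  suffices f = 0 from LinearMap.congr_fun this v
  ext x
  exact ι.toRingHom.injective ((LinearMap.congr_fun
    (h (ι.toLinearMap ∘ₗ f.restrictScalars R ∘ₗ TensorProduct.mk R κ M 1)) x).trans
    (map_zero ι).symm)

/-- The fibre of `Spec R → Spec A` through the `F`-point of `R` is unramified there, hence so is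
the generic fibre. -/
theorem isAlgebraic_of_forall_derivation_eq_zero {A R F : Type*} [CommRing A] [IsDomain A]
    [CommRing R] [IsDomain R] [Algebra A R] [FaithfulSMul A R] [Algebra.FiniteType A R] [Field F]
    [Algebra A F] [Algebra R F] [IsScalarTower A R F] (h : ∀ D : Derivation A R F, D = 0) :
    Algebra.IsAlgebraic A R := by
  let K := FractionRing R
  let L := FractionRing A
  let : Algebra L K := FractionRing.liftAlgebra A K
  have : IsScalarTower A L K := FractionRing.isScalarTower_liftAlgebra A K
  have : Algebra.EssFiniteType R K := Algebra.EssFiniteType.of_isLocalization K (nonZeroDivisors R)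
  have : Algebra.EssFiniteType A K := Algebra.EssFiniteType.comp A R K
  have : Algebra.EssFiniteType L K := Algebra.EssFiniteType.of_comp A L K
  have hlin : ∀ f : Ω[R⁄A] →ₗ[R] F, f = 0 := fun f =>
    (KaehlerDifferential.linearMapEquivDerivation A R).injective ((h _).trans (h _).symm)
  have hder : ∀ D : Derivation L K K, D = 0 := by
    intro D
    let D₁ : Derivation A R K := (D.restrictScalars A).compAlgebraMap R
    have hD₁ : ∀ a : R, D (algebraMap R K a) = 0 := fun a => by
      obtain ⟨r, hr, hra⟩ :=
        exists_algebraMap_ne_zero_smul_eq_zero hlin (KaehlerDifferential.D A R a)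
      have hr0 : r ≠ 0 := ne_zero_of_map hr
      have := congrArg D₁.liftKaehlerDifferential hra
      rw [map_smul, Derivation.liftKaehlerDifferential_comp_D, map_zero, smul_eq_zero] at this
      exact this.resolve_left hr0
    ext y
    obtain ⟨a, b, -, rfl⟩ := IsFractionRing.div_surjective (A := R) y
    rw [Derivation.leibniz_div, hD₁, hD₁, smul_zero, smul_zero, sub_zero, smul_zero]
    rfl
  have : Subsingleton (Ω[K⁄L]) := by
    refine subsingleton_of_forall_eq 0 fun a =>
      (Module.forall_dual_apply_eq_zero_iff K a).1 fun f => ?_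
    have : f = 0 := (KaehlerDifferential.linearMapEquivDerivation L K).injective
      ((hder _).trans (hder _).symm)
    rw [this, LinearMap.zero_apply]
  have : Algebra.FormallyUnramified L K := ⟨this⟩
  have := Algebra.FormallyUnramified.isSeparable L K
  refine ⟨fun x => ?_⟩
  have hx : IsAlgebraic L (algebraMap R K x) := (Algebra.IsSeparable.isIntegral L _).isAlgebraic
  rw [← IsFractionRing.isAlgebraic_iff A L K] at hx
  exact (isAlgebraic_algebraMap_iff (FaithfulSMul.algebraMap_injective R K)).1 hx

theorem isAlgebraic_adjoin_of_forall_derivation_eq_zero {k R F : Type*} [Field k] [CommRing R]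
    [IsDomain R] [Algebra k R] [Algebra.FiniteType k R] [Field F] [Algebra k F] [Algebra R F]
    [IsScalarTower k R F] (s : Set R)
    (h : ∀ D : Derivation k R F, (∀ a ∈ s, D a = 0) → D = 0) :
    Algebra.IsAlgebraic (Algebra.adjoin k s) R := by
  have : Algebra.FiniteType (Algebra.adjoin k s) R :=
    Algebra.FiniteType.of_restrictScalars_finiteType k _ R
  refine isAlgebraic_of_forall_derivation_eq_zero (F := F) fun D => ?_
  have := h (D.restrictScalars k) fun a ha =>
    D.map_algebraMap ⟨a, Algebra.subset_adjoin ha⟩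
  ext x
  exact DFunLike.congr_fun this x

end UnramifiedPoint

section Specializations

variable {k R : Type*} [Field k] [CommRing R] [Algebra k R]

theorem exists_ne_zero_finite_specializations (s : Set R) (x : R)
    (hx : IsAlgebraic (Algebra.adjoin k s) x) :
    ∃ c : R, c ≠ 0 ∧ ∀ φ : R →ₐ[k] k, φ c ≠ 0 →
      {w : k | ∃ ψ : R →ₐ[k] k, (∀ a ∈ s, ψ a = φ a) ∧ ψ x = w}.Finite := by
  obtain ⟨q, hq0, hq⟩ := hx
  refine ⟨(q.leadingCoeff : R), by simpa using hq0, fun φ hφ => ?_⟩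
  let Q : Polynomial k := q.map (φ.comp (Algebra.adjoin k s).val).toRingHom
  have hQ : Q ≠ 0 := fun h => hφ <| by
    have := congrArg (Polynomial.coeff · q.natDegree) h
    rwa [Polynomial.coeff_map, Polynomial.coeff_zero] at this
  refine (Q.rootSet_finite k).subset ?_
  rintro w ⟨ψ, hψ, rfl⟩
  have hagree : φ.comp (Algebra.adjoin k s).val = ψ.comp (Algebra.adjoin k s).val := by
    ext ⟨a, ha⟩
    exact (AlgHom.eqOn_adjoin_iff.2 (fun b hb => hψ b hb) ha).symm
  rw [Polynomial.mem_rootSet, Polynomial.coe_aeval_eq_eval, Polynomial.eval_map, hagree]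
  refine ⟨hQ, ?_⟩
  have := congrArg ψ hq
  rw [Polynomial.aeval_def, map_zero] at this
  exact (Polynomial.hom_eval₂ q _ ψ.toRingHom x).symm.trans this

theorem exists_mvPolynomial_ne_zero_forall_eval_eq_zero [IsDomain R] {τ : Type*} (t : τ → R) {x : R}
    (hx : IsAlgebraic (Algebra.adjoin k (Set.range t)) x) (hx0 : x ≠ 0) :
    ∃ F : MvPolynomial τ k, F ≠ 0 ∧ ∀ φ : R →ₐ[k] k, φ x = 0 →
      MvPolynomial.eval (fun i => φ (t i)) F = 0 := by
  obtain ⟨q, hq0, hq⟩ := hx.exists_nonzero_coeff_and_aeval_eq_zero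
    (mem_nonZeroDivisors_of_ne_zero hx0)
  obtain ⟨F, hF⟩ := (Algebra.adjoin_range_eq_range_aeval k t).le (q.coeff 0).2
  refine ⟨F, ?_, fun φ hφ => ?_⟩
  · rintro rfl
    exact hq0 (Subtype.ext (hF.symm.trans (map_zero _)))
  · have heval : MvPolynomial.eval (fun i => φ (t i)) F = φ (q.coeff 0) := by
      rw [← hF, ← MvPolynomial.coe_aeval_eq_eval]
      exact (MvPolynomial.comp_aeval_apply _ φ F).symm
    have := congrArg φ hq
    rw [Polynomial.aeval_def, map_zero] at this
    have h0 := (Polynomial.hom_eval₂ q (algebraMap (Algebra.adjoin k (Set.range t)) R)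
      φ.toRingHom x).symm.trans this
    change Polynomial.eval₂ _ (φ x) q = 0 at h0
    rw [hφ, Polynomial.eval₂_at_zero] at h0
    exact heval.trans h0

end Specializations

open Cardinal in
theorem exists_mvPolynomial_ne_zero_aeval_eq_zero {k σ τ : Type*} [Field k] [Fintype σ]
    [Fintype τ] (hcard : Fintype.card σ < Fintype.card τ) (f : τ → MvPolynomial σ k) :
    ∃ F : MvPolynomial τ k, F ≠ 0 ∧ MvPolynomial.aeval f F = 0 := by
  by_contra! hF
  have hf : AlgebraicIndependent k f := (injective_iff_map_eq_zero _).2 fun F hF0 =>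
    not_imp_comm.1 (hF F) (not_not_intro hF0)
  have := hf.lift_cardinalMk_le_trdeg
  rw [MvPolynomial.trdeg_of_isDomain] at this
  simp only [Cardinal.mk_fintype, Cardinal.lift_natCast, Nat.cast_le] at this
  exact hcard.not_ge this

theorem exists_equiv_of_map_univ_eq {α β γ : Type*} [Fintype α] [Fintype β] (f : α → γ)
    (g : β → γ) (h : Finset.univ.val.map f = Finset.univ.val.map g) :
    ∃ e : α ≃ β, ∀ a, g (e a) = f a := by
  classical
  have hcard : ∀ c, Fintype.card {a // f a = c} = Fintype.card {b // g b = c} := fun c => by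
    have := congrArg (Multiset.count c) h
    rw [Multiset.count_map, Multiset.count_map] at this
    rw [Fintype.card_subtype, Fintype.card_subtype]
    simpa only [Finset.card_def, Finset.filter_val, eq_comm] using this
  let e : α ≃ β := (Equiv.sigmaFiberEquiv f).symm.trans
    ((Equiv.sigmaCongrRight fun c => Fintype.equivOfCardEq (hcard c)).trans
      (Equiv.sigmaFiberEquiv g))
  exact ⟨e, fun a => (Fintype.equivOfCardEq (hcard (f a)) ⟨a, rfl⟩).2⟩

noncomputable section

namespace QuadVF

open Matrix MvPolynomial

section Veronese

variable {S S' : Type*} [CommRing S] [CommRing S']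

/-- The pairs of indices of the quadratic monomials in three variables. Vectors indexed by the
monomials, in this order, represent quadratic forms and points of `Sym²`. -/
def quadIdx : Fin 6 → Fin 3 × Fin 3 := ![(0, 0), (1, 1), (2, 2), (1, 2), (0, 2), (0, 1)]

/-- The Veronese map: the values of the six quadratic monomials. -/
def veronese (z : Fin 3 → S) : Fin 6 → S :=
  fun J => z (quadIdx J).1 * z (quadIdx J).2

theorem exists_quadIdx_eq : ∀ i j : Fin 3, ∃ J, quadIdx J = (i, j) ∨ quadIdx J = (j, i) := by
  decide

/-- The matrix of the differential of the Veronese map. -/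
def dVeronese (z : Fin 3 → S) : Matrix (Fin 6) (Fin 3) S :=
  Matrix.of fun J j => (if j = (quadIdx J).1 then z (quadIdx J).2 else 0) +
    (if j = (quadIdx J).2 then z (quadIdx J).1 else 0)

theorem dVeronese_mulVec (z w : Fin 3 → S) (J : Fin 6) :
    (dVeronese z *ᵥ w) J =
      z (quadIdx J).1 * w (quadIdx J).2 + w (quadIdx J).1 * z (quadIdx J).2 := by
  simp only [Matrix.mulVec, dotProduct, dVeronese, Matrix.of_apply, add_mul, ite_mul, zero_mul,
    Finset.sum_add_distrib, Finset.sum_ite_eq', Finset.mem_univ, if_true]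
  ring

theorem veronese_add (z w : Fin 3 → S) :
    veronese (z + w) = veronese z + dVeronese z *ᵥ w + veronese w := by
  ext J
  simp only [Pi.add_apply, dVeronese_mulVec, veronese]
  ring

theorem veronese_smul (c : S) (z : Fin 3 → S) : veronese (c • z) = c ^ 2 • veronese z := by
  ext J
  simp only [Pi.smul_apply, smul_eq_mul, veronese]
  ring

theorem veronese_zero : veronese (0 : Fin 3 → S) = 0 := by
  ext J
  exact mul_zero _

theorem dVeronese_smul (c : S) (z : Fin 3 → S) : dVeronese (c • z) = c • dVeronese z := by
  ext J j
  simp only [dVeronese, Matrix.of_apply, Matrix.smul_apply, Pi.smul_apply, smul_eq_mul, mul_add,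
    mul_ite, mul_zero]

theorem dVeronese_add (z w : Fin 3 → S) : dVeronese (z + w) = dVeronese z + dVeronese w := by
  ext J j
  simp only [dVeronese, Matrix.of_apply, Matrix.add_apply, Pi.add_apply]
  split_ifs <;> ring

theorem dVeronese_self (z : Fin 3 → S) : dVeronese z *ᵥ z = (2 : S) • veronese z := by
  ext J
  simp only [dVeronese_mulVec, veronese, Pi.smul_apply, smul_eq_mul]
  ring

theorem map_veronese (φ : S →+* S') (z : Fin 3 → S) (J : Fin 6) :
    φ (veronese z J) = veronese (φ ∘ z) J :=
  map_mul φ _ _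

theorem map_dVeronese (φ : S →+* S') (z : Fin 3 → S) :
    (dVeronese z).map φ = dVeronese (φ ∘ z) := by
  ext J j
  simp only [dVeronese, Matrix.map_apply, Matrix.of_apply, map_add, apply_ite φ, map_zero,
    Function.comp_apply]

/-- The action of a linear map on quadratic monomials. -/
def symSquare (A : Matrix (Fin 3) (Fin 3) S) : Matrix (Fin 6) (Fin 6) S :=
  Matrix.of fun I J => if (quadIdx J).1 = (quadIdx J).2 then
      A (quadIdx I).1 (quadIdx J).1 * A (quadIdx I).2 (quadIdx J).2
    else A (quadIdx I).1 (quadIdx J).1 * A (quadIdx I).2 (quadIdx J).2 +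
      A (quadIdx I).1 (quadIdx J).2 * A (quadIdx I).2 (quadIdx J).1

theorem veronese_mulVec (A : Matrix (Fin 3) (Fin 3) S) (z : Fin 3 → S) :
    veronese (A *ᵥ z) = symSquare A *ᵥ veronese z := by
  ext I
  simp only [veronese, symSquare, Matrix.mulVec, dotProduct, Matrix.of_apply, Fin.sum_univ_three,
    Fin.sum_univ_six]
  simp [quadIdx]
  ring

/-- The exponent vectors of the six quadratic monomials. -/
def quadMon (J : Fin 6) : Fin 3 →₀ ℕ :=
  Finsupp.single (quadIdx J).1 1 + Finsupp.single (quadIdx J).2 1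

theorem quadMon_apply (J : Fin 6) (i : Fin 3) :
    quadMon J i = (if (quadIdx J).1 = i then 1 else 0) + if (quadIdx J).2 = i then 1 else 0 := by
  simp only [quadMon, Finsupp.add_apply, Finsupp.single_apply]

theorem quadMon_injective : Function.Injective quadMon := by
  have key : ∀ I J : Fin 6, (∀ i : Fin 3,
      ((if (quadIdx I).1 = i then 1 else 0) + if (quadIdx I).2 = i then 1 else 0) =
        (if (quadIdx J).1 = i then 1 else 0) + if (quadIdx J).2 = i then 1 else 0) → I = J := by
    decide
  intro I J h
  refine key I J fun i => ?_
  rw [← quadMon_apply, ← quadMon_apply, h]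

theorem exists_quadMon_eq (d : Fin 3 →₀ ℕ) (hd : d 0 + d 1 + d 2 = 2) : ∃ J, quadMon J = d := by
  have key : ∀ a b c : Fin 3, (a + b + c : ℕ) = 2 → ∃ J : Fin 6, ∀ i : Fin 3,
      ((if (quadIdx J).1 = i then 1 else 0) + if (quadIdx J).2 = i then 1 else 0) =
        (![a, b, c] i : ℕ) := by
    decide
  obtain ⟨J, hJ⟩ := key ⟨d 0, by omega⟩ ⟨d 1, by omega⟩ ⟨d 2, by omega⟩ hd
  refine ⟨J, Finsupp.ext fun i => ?_⟩
  rw [quadMon_apply, hJ]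
  fin_cases i <;> rfl

/-- The quadratic form with given coefficients. -/
def quadPoly (c : Fin 6 → S) : MvPolynomial (Fin 3) S :=
  ∑ J, monomial (quadMon J) (c J)

theorem coeff_quadPoly (c : Fin 6 → S) (J : Fin 6) : coeff (quadMon J) (quadPoly c) = c J := by
  simp [quadPoly, coeff_sum, coeff_monomial, quadMon_injective.eq_iff]

theorem isHomogeneous_quadPoly (c : Fin 6 → S) : (quadPoly c).IsHomogeneous 2 := by
  refine IsHomogeneous.sum _ _ _ fun J _ => isHomogeneous_monomial _ ?_
  simp [quadMon, map_add]

theorem monomial_quadMon (c : S) (J : Fin 6) :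
    monomial (quadMon J) c = C c * (X (quadIdx J).1 * X (quadIdx J).2) := by
  rw [X, X, monomial_mul, C_mul_monomial, quadMon]
  simp

theorem eval_quadPoly (c : Fin 6 → S) (z : Fin 3 → S) :
    eval z (quadPoly c) = c ⬝ᵥ veronese z := by
  simp [quadPoly, monomial_quadMon, dotProduct, veronese]

theorem eval_pderiv_quadPoly (c : Fin 6 → S) (z : Fin 3 → S) (j : Fin 3) :
    eval z (pderiv j (quadPoly c)) = ∑ J, c J * dVeronese z J j := by
  simp only [quadPoly, monomial_quadMon, map_sum, Derivation.leibniz, pderiv_C,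
    smul_eq_mul, map_mul, map_add, eval_C, eval_X, dVeronese, Matrix.of_apply,
    pderiv_X, Pi.single_apply, apply_ite (eval z), map_one, map_zero]
  refine Finset.sum_congr rfl fun J _ => ?_
  simp only [eq_comm (a := j), mul_ite, mul_one, mul_zero, mul_add]
  ring

theorem eq_quadPoly_of_isHomogeneous {P : MvPolynomial (Fin 3) S} (hP : P.IsHomogeneous 2) :
    P = quadPoly fun J => coeff (quadMon J) P := by
  ext d
  by_cases hd : d 0 + d 1 + d 2 = 2
  · obtain ⟨J, rfl⟩ := exists_quadMon_eq d hd
    rw [coeff_quadPoly]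
  · have hd' : d.degree ≠ 2 := by
      rwa [Finsupp.degree_eq_sum, Fin.sum_univ_three]
    rw [hP.coeff_eq_zero hd', (isHomogeneous_quadPoly _).coeff_eq_zero hd']

end Veronese

/-- The coefficients of a quadratic vector field on `ℂ^3`, as a matrix. -/
def coeffMatrix (X : QuadVF 3) : Matrix (Fin 3) (Fin 6) ℂ :=
  Matrix.of fun i J => coeff (quadMon J) (X i : MvPolynomial (Fin 3) ℂ)

/-- The quadratic vector field on `ℂ^3` with a given matrix of coefficients. -/
def ofMatrix (T : Matrix (Fin 3) (Fin 6) ℂ) : QuadVF 3 :=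
  fun i => ⟨quadPoly (T i), isHomogeneous_quadPoly _⟩

theorem coeffMatrix_ofMatrix (T : Matrix (Fin 3) (Fin 6) ℂ) : (ofMatrix T).coeffMatrix = T := by
  ext i J
  exact coeff_quadPoly _ _

theorem eq_quadPoly (X : QuadVF 3) (i : Fin 3) :
    (X i : MvPolynomial (Fin 3) ℂ) = quadPoly (X.coeffMatrix i) :=
  eq_quadPoly_of_isHomogeneous (X i).2

theorem value_eq (X : QuadVF 3) (z : Fin 3 → ℂ) : X.value z = X.coeffMatrix *ᵥ veronese z := by
  ext i
  rw [value, eq_quadPoly, eval_quadPoly]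
  rfl

theorem jacobian_eq (X : QuadVF 3) (z : Fin 3 → ℂ) :
    X.jacobian z = X.coeffMatrix * dVeronese z := by
  ext i j
  rw [jacobian, Matrix.of_apply, eq_quadPoly, eval_pderiv_quadPoly]
  rfl

/-- A property of coefficient matrices holds generically. -/
def GenericallyMatrix (p : Matrix (Fin 3) (Fin 6) ℂ → Prop) : Prop :=
  ∃ F : MvPolynomial (Fin 3 × Fin 6) ℂ, F ≠ 0 ∧ ∀ T, eval (fun q => T q.1 q.2) F ≠ 0 → p T

theorem GenericallyMatrix.and {p q : Matrix (Fin 3) (Fin 6) ℂ → Prop} (hp : GenericallyMatrix p)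
    (hq : GenericallyMatrix q) : GenericallyMatrix fun T => p T ∧ q T := by
  obtain ⟨F, hF, hFp⟩ := hp
  obtain ⟨G, hG, hGq⟩ := hq
  refine ⟨F * G, mul_ne_zero hF hG, fun T hT => ?_⟩
  rw [map_mul] at hT
  exact ⟨hFp T (left_ne_zero_of_mul hT), hGq T (right_ne_zero_of_mul hT)⟩

theorem GenericallyMatrix.generically {p : Matrix (Fin 3) (Fin 6) ℂ → Prop}
    (hp : GenericallyMatrix p) : Generically (n := 3) fun X => p X.coeffMatrix := by
  obtain ⟨F, hF, hFp⟩ := hp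
  have key : ∀ X : QuadVF 3,
      eval X.coeffs (rename (fun q : Fin 3 × Fin 6 => (q.1, quadMon q.2)) F) =
      eval (fun q => X.coeffMatrix q.1 q.2) F := fun X => by
    rw [eval_rename]; rfl
  refine ⟨rename (fun q : Fin 3 × Fin 6 => (q.1, quadMon q.2)) F, ?_, fun X hX => ?_⟩
  · obtain ⟨x, hx⟩ : ∃ x, eval x F ≠ 0 := by
      by_contra! h
      exact hF (MvPolynomial.funext fun x => by rw [h x, map_zero])
    refine ⟨ofMatrix (Matrix.of fun i J => x (i, J)), ?_⟩
    rw [key, coeffMatrix_ofMatrix]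
    exact hx
  · rw [key] at hX
    exact hFp _ hX

section FixedPoints

variable {K : Type*} [Field K]

/-- A nonzero fixed point of the quadratic map `z ↦ T *ᵥ veronese z` that is simple as a zero of
`z - T *ᵥ veronese z`. -/
structure IsSimpleFixedPoint (T : Matrix (Fin 3) (Fin 6) K) (a : Fin 3 → K) : Prop where
  ne_zero : a ≠ 0
  fixed : T *ᵥ veronese a = a
  det_ne_zero : (1 - T * dVeronese a).det ≠ 0

/-- A Bezoutian of `x - T *ᵥ veronese x` at `a`: a cubic polynomial in `x` that separates `a` from
all other fixed points, see `bezoutian_eq_zero` and `bezoutian_self`. -/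
def bezoutian (T : Matrix (Fin 3) (Fin 6) K) (a x : Fin 3 → K) : K :=
  ((2 : K) • 1 - T * dVeronese (a + x)).det

theorem dVeronese_add_mulVec_sub (a x : Fin 3 → K) :
    dVeronese (a + x) *ᵥ (a - x) = (2 : K) • (veronese a - veronese x) := by
  ext J
  simp only [dVeronese_mulVec, veronese, Pi.smul_apply, Pi.add_apply, Pi.sub_apply, smul_eq_mul]
  ring

theorem bezoutian_eq_zero {T : Matrix (Fin 3) (Fin 6) K} {a x : Fin 3 → K}
    (ha : T *ᵥ veronese a = a) (hx : T *ᵥ veronese x = x) (hne : a ≠ x) :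
    bezoutian T a x = 0 := by
  refine exists_mulVec_eq_zero_iff.1 ⟨a - x, sub_ne_zero.2 hne, ?_⟩
  rw [sub_mulVec, smul_mulVec, one_mulVec, ← mulVec_mulVec, dVeronese_add_mulVec_sub, mulVec_smul,
    mulVec_sub, ha, hx, sub_self]

theorem bezoutian_self (T : Matrix (Fin 3) (Fin 6) K) (a : Fin 3 → K) :
    bezoutian T a a = 2 ^ 3 * (1 - T * dVeronese a).det := by
  rw [bezoutian, ← two_smul K a, dVeronese_smul, Matrix.mul_smul, ← smul_sub, det_smul,
    Fintype.card_fin]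

theorem det_sub_fin_three (A N : Matrix (Fin 3) (Fin 3) K) :
    (A - N).det = A.det - (A.adjugate * N).trace + (A * N.adjugate).trace - N.det := by
  simp only [det_fin_three, adjugate_fin_three, trace_fin_three, mul_apply, Fin.sum_univ_three,
    Matrix.sub_apply, of_apply, cons_val]
  ring

/-- The linear map `z ↦ T * dVeronese z`. -/
def jacobianMap (T : Matrix (Fin 3) (Fin 6) K) :
    (Fin 3 → K) →ₗ[K] Matrix (Fin 3) (Fin 3) K where
  toFun z := T * dVeronese z
  map_add' z w := by rw [dVeronese_add, Matrix.mul_add]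
  map_smul' c z := by rw [dVeronese_smul, Matrix.mul_smul, RingHom.id_apply]

theorem bezoutian_eq (T : Matrix (Fin 3) (Fin 6) K) (a x : Fin 3 → K) :
    bezoutian T a x = bezoutian T a 0 -
      (((2 : K) • 1 - jacobianMap T a).adjugate * jacobianMap T x).trace +
      (((2 : K) • 1 - jacobianMap T a) * (jacobianMap T x).adjugate).trace -
      (jacobianMap T x).det := by
  have h : ∀ y, bezoutian T a y = ((2 : K) • 1 - jacobianMap T a - jacobianMap T y).det :=
    fun y => by
      rw [sub_sub, ← map_add]
      rfl
  rw [h, h, map_zero, sub_zero, det_sub_fin_three]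

section VeroneseRelation

variable {ι : Type*} [Fintype ι] {p : ι → Fin 3 → K} {μ : ι → K}

theorem sum_mul_dual_mul_dual_eq_zero (h : ∑ k, μ k • veronese (p k) = 0)
    (φ ψ : Module.Dual K (Fin 3 → K)) : ∑ k, μ k * (φ (p k) * ψ (p k)) = 0 := by
  have hcoord : ∀ i j : Fin 3, ∑ k, μ k * (p k i * p k j) = 0 := fun i j => by
    obtain ⟨J, hJ⟩ := exists_quadIdx_eq i j
    have hsum := congrFun h J
    simp only [Finset.sum_apply, Pi.smul_apply, smul_eq_mul, veronese, Pi.zero_apply] at hsum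
    rcases hJ with hJ | hJ <;> rw [hJ] at hsum
    · exact hsum
    · simpa only [mul_comm (p _ i)] using hsum
  let e : Fin 3 → Fin 3 → K := fun i j => if i = j then 1 else 0
  calc ∑ k, μ k * (φ (p k) * ψ (p k))
      = ∑ k, ∑ i, ∑ j, φ (e i) * ψ (e j) * (μ k * (p k i * p k j)) := by
        refine Finset.sum_congr rfl fun k _ => ?_
        rw [LinearMap.pi_apply_eq_sum_univ φ, LinearMap.pi_apply_eq_sum_univ ψ, Finset.sum_mul_sum,
          Finset.mul_sum]
        refine Finset.sum_congr rfl fun i _ => ?_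
        rw [Finset.mul_sum]
        refine Finset.sum_congr rfl fun j _ => ?_
        simp only [smul_eq_mul, e]
        ring
    _ = 0 := by
        rw [Finset.sum_comm]
        refine Finset.sum_eq_zero fun i _ => ?_
        rw [Finset.sum_comm]
        refine Finset.sum_eq_zero fun j _ => ?_
        rw [← Finset.mul_sum, hcoord, mul_zero]

theorem sum_mul_bezoutian_sub_eq_zero {T : Matrix (Fin 3) (Fin 6) K}
    (hp : ∀ k, T *ᵥ veronese (p k) = p k) (h : ∑ k, μ k • veronese (p k) = 0) {a b : Fin 3 → K}
    (hab : bezoutian T a 0 = bezoutian T b 0) :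
    ∑ k, μ k * (bezoutian T a (p k) - bezoutian T b (p k)) = 0 := by
  have hlin : ∑ k, μ k • p k = 0 := by
    calc ∑ k, μ k • p k = T *ᵥ ∑ k, μ k • veronese (p k) := by
          rw [mulVec_sum]
          exact Finset.sum_congr rfl fun k _ => by rw [mulVec_smul, hp]
      _ = 0 := by rw [h, mulVec_zero]
  have hN : ∑ k, μ k • jacobianMap T (p k) = 0 := by
    rw [← map_zero (jacobianMap T), ← hlin, map_sum]
    exact Finset.sum_congr rfl fun k _ => (map_smul _ _ _).symm
  have hadj : ∑ k, μ k • (jacobianMap T (p k)).adjugate = 0 := by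
    have hentry : ∀ i j i' j',
        ∑ k, μ k * (jacobianMap T (p k) i j * jacobianMap T (p k) i' j') = 0 := fun i j i' j' =>
      sum_mul_dual_mul_dual_eq_zero h
        (entryLinearMap K K i j ∘ₗ jacobianMap T) (entryLinearMap K K i' j' ∘ₗ jacobianMap T)
    ext i j
    simp only [Matrix.sum_apply, Matrix.smul_apply, adjugate_fin_succ_eq_det_submatrix, det_fin_two,
      submatrix_apply, smul_eq_mul, mul_left_comm (μ _) ((-1) ^ _), ← Finset.mul_sum, mul_sub,
      Finset.sum_sub_distrib, hentry, sub_zero, mul_zero, Matrix.zero_apply]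
  let D := jacobianMap T b - jacobianMap T a
  let E := ((2 : K) • 1 - jacobianMap T b).adjugate - ((2 : K) • 1 - jacobianMap T a).adjugate
  have hsub : ∀ x, bezoutian T a x - bezoutian T b x =
      (E * jacobianMap T x).trace + (D * (jacobianMap T x).adjugate).trace := fun x => by
    rw [bezoutian_eq T a, bezoutian_eq T b, hab]
    simp only [D, E, Matrix.sub_mul, trace_sub]
    ring
  calc ∑ k, μ k * (bezoutian T a (p k) - bezoutian T b (p k))
      = (E * ∑ k, μ k • jacobianMap T (p k)).trace +
          (D * ∑ k, μ k • (jacobianMap T (p k)).adjugate).trace := by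
        simp only [hsub, mul_add, Finset.sum_add_distrib, Matrix.mul_sum, Matrix.mul_smul,
          trace_sum, trace_smul, smul_eq_mul]
    _ = 0 := by rw [hN, hadj, Matrix.mul_zero, Matrix.mul_zero, trace_zero, add_zero]

end VeroneseRelation

theorem linearIndependent_veronese [NeZero (2 : K)] {T : Matrix (Fin 3) (Fin 6) K} {ι : Type*}
    [Finite ι] {p : ι → Fin 3 → K} (hp : ∀ k, IsSimpleFixedPoint T (p k))
    (hinj : Function.Injective p) {m : Fin 3 → K} (hm0 : m ≠ 0) (hm : T *ᵥ veronese m = m)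
    (hmp : ∀ k, p k ≠ m) : LinearIndependent K fun k => veronese (p k) := by
  classical
  cases nonempty_fintype ι
  refine Fintype.linearIndependent_iff.2 fun μ hμ j => ?_
  have hzero : T *ᵥ veronese (0 : Fin 3 → K) = 0 := by rw [veronese_zero, mulVec_zero]
  have hsum := sum_mul_bezoutian_sub_eq_zero (fun k => (hp k).fixed) hμ
    (a := p j) (b := m) <| by
      rw [bezoutian_eq_zero (hp j).fixed hzero (hp j).ne_zero, bezoutian_eq_zero hm hzero hm0]
  rw [Finset.sum_eq_single j] at hsum
  · rw [bezoutian_eq_zero hm (hp j).fixed (hmp j).symm, sub_zero, bezoutian_self] at hsum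
    exact (mul_eq_zero.1 hsum).resolve_right
      (mul_ne_zero (pow_ne_zero 3 two_ne_zero) (hp j).det_ne_zero)
  · intro k _ hkj
    rw [bezoutian_eq_zero (hp j).fixed (hp k).fixed (hinj.ne hkj.symm),
      bezoutian_eq_zero hm (hp k).fixed (hmp k).symm, sub_zero, mul_zero]
  · exact fun h => absurd (Finset.mem_univ j) h

end FixedPoints

section SixPoints

variable {S : Type*} [CommRing S]

/-- The matrix whose rows are the images of six points under the Veronese map. It is invertible
exactly when no conic contains the six points. -/
def veroneseMatrix (y : Fin 6 → Fin 3 → S) : Matrix (Fin 6) (Fin 6) S :=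
  Matrix.of fun k => veronese (y k)

/-- The embedding of the indices of a basis of `K^3` into those of six points. -/
def firstThree : Fin 3 ↪ Fin 6 := (Fin.castAddEmb 3 : Fin 3 ↪ Fin (3 + 3))

variable {K : Type*} [Field K]

theorem span_range_eq_top_of_det_veroneseMatrix_ne_zero {y : Fin 6 → Fin 3 → K}
    (hy : (veroneseMatrix y).det ≠ 0) : Submodule.span K (Set.range y) = ⊤ := by
  by_contra hspan
  obtain ⟨φ, hφ0, hφ⟩ := Submodule.exists_le_ker_of_lt_top _ (lt_top_iff_ne_top.2 hspan)
  have hφy : ∀ k, φ (y k) = 0 := fun k => hφ (Submodule.subset_span ⟨k, rfl⟩)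
  refine hφ0 (LinearMap.ext fun z => ?_)
  obtain ⟨μ, hμ⟩ : ∃ μ : Fin 6 → K, ∑ k, μ k • veronese (y k) = veronese z := by
    obtain ⟨μ, hμ⟩ := vecMul_surjective_iff_isUnit.2
      ((isUnit_iff_isUnit_det _).2 (isUnit_iff_ne_zero.2 hy)) (veronese z)
    exact ⟨μ, (vecMul_eq_sum _ _).symm.trans hμ⟩
  have hsum := sum_mul_dual_mul_dual_eq_zero (p := fun k : Option (Fin 6) => k.elim z y)
    (μ := fun k => k.elim (-1) μ)
    (by simp only [Fintype.sum_option, Option.elim, hμ, neg_smul, one_smul, neg_add_cancel]) φ φ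
  simpa [Fintype.sum_option, hφy] using hsum

variable {T : Matrix (Fin 3) (Fin 6) K} {p : Fin 7 → Fin 3 → K}

theorem det_veroneseMatrix_ne_zero [NeZero (2 : K)] (hp : ∀ k, IsSimpleFixedPoint T (p k))
    (hinj : Function.Injective p) (σ : Fin 6 ↪ Fin 7) : (veroneseMatrix (p ∘ σ)).det ≠ 0 := by
  obtain ⟨m, hm⟩ : ∃ m, m ∉ Set.range σ := by
    by_contra! h
    exact absurd (Fintype.card_le_of_surjective σ h) (by decide)
  have hli := linearIndependent_veronese (fun k => hp (σ k)) (hinj.comp σ.injective)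
    (hp m).ne_zero (hp m).fixed fun k h => hm ⟨k, hinj h⟩
  exact ((isUnit_iff_isUnit_det _).1 (linearIndependent_rows_iff_isUnit.1 hli)).ne_zero

theorem exists_eq_of_mulVec_veronese_eq [NeZero (2 : K)] (hp : ∀ k, IsSimpleFixedPoint T (p k))
    (hinj : Function.Injective p) {m : Fin 3 → K} (hm0 : m ≠ 0) (hm : T *ᵥ veronese m = m) :
    ∃ k, p k = m := by
  by_contra! hne
  have hcard := (linearIndependent_veronese hp hinj hm0 hm hne).fintype_card_le_finrank
  simp only [Fintype.card_fin, Module.finrank_fin_fun] at hcard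
  omega

theorem exists_embedding_det_ne_zero [NeZero (2 : K)] (hp : ∀ k, IsSimpleFixedPoint T (p k))
    (hinj : Function.Injective p) :
    ∃ σ : Fin 6 ↪ Fin 7, (Matrix.of fun i => p (σ (firstThree i))).det ≠ 0 := by
  have hspan := span_range_eq_top_of_det_veroneseMatrix_ne_zero
    (det_veroneseMatrix_ne_zero hp hinj Fin.castSuccEmb)
  obtain ⟨κ, a, ha, haspan, hli⟩ := exists_linearIndependent' K (p ∘ Fin.castSuccEmb)
  rw [hspan] at haspan
  have : Fintype κ := Fintype.ofInjective a ha
  let b := Module.Basis.mk hli haspan.ge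
  have hcard : Fintype.card κ = Fintype.card (Fin 3) := by
    rw [← Module.finrank_eq_card_basis b, Module.finrank_fin_fun, Fintype.card_fin]
  let e : Fin 3 ≃ κ := (Fintype.equivOfCardEq hcard).symm
  obtain ⟨g, hg⟩ := Equiv.Perm.exists_extending_pair (fun i => (firstThree i).castSucc)
    (fun i => (a (e i)).castSucc) ((Fin.castSucc_injective 6).comp firstThree.injective)
    ((Fin.castSucc_injective 6).comp (ha.comp e.injective))
  refine ⟨Fin.castSuccEmb.trans g.toEmbedding, ?_⟩
  have hrow : (Matrix.of fun i => p ((Fin.castSuccEmb.trans g.toEmbedding) (firstThree i))) =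
      Matrix.of fun i => p (a (e i)).castSucc :=
    congrArg Matrix.of (_root_.funext fun i => congrArg p (hg i))
  rw [hrow]
  exact ((isUnit_iff_isUnit_det _).1
    (linearIndependent_rows_iff_isUnit.1 (hli.comp e e.injective))).ne_zero

end SixPoints

section VanishingLocus

variable (i : Fin 3)

/-- The variables parametrizing the pairs of a field and a zero of it in the chart `z i = 1`: the
coefficients other than those of the square of the `i`-th coordinate, and the coordinates of the
zero other than the `i`-th one. -/
abbrev ChartVar : Type := (Fin 3 × {J // J ≠ firstThree i}) ⊕ {j // j ≠ i}

/-- The universal zero in the chart `z i = 1`. -/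
def chartZero (j : Fin 3) : MvPolynomial (ChartVar i) ℂ :=
  if h : j = i then 1 else X (Sum.inr ⟨j, h⟩)

/-- The universal field vanishing at `chartZero i`. -/
def chartField (q : Fin 3 × Fin 6) : MvPolynomial (ChartVar i) ℂ :=
  if h : q.2 = firstThree i then -∑ J, X (Sum.inl (q.1, J)) * veronese (chartZero i) J.1
  else X (Sum.inl (q.1, ⟨q.2, h⟩))

variable {i} in
/-- The parameters of a field `T` and a zero `z` of it in the chart `z i = 1`. -/
def chartParams (T : Matrix (Fin 3) (Fin 6) ℂ) (z : Fin 3 → ℂ) : ChartVar i → ℂ :=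
  Sum.elim (fun q => T q.1 q.2) fun j => z j

theorem card_chartVar_lt : Fintype.card (ChartVar i) < Fintype.card (Fin 3 × Fin 6) := by
  revert i
  decide

theorem quadIdx_firstThree : quadIdx (firstThree i) = (i, i) := by
  revert i
  decide

variable {i}

theorem eval_chartZero (T : Matrix (Fin 3) (Fin 6) ℂ) {z : Fin 3 → ℂ} (hzi : z i = 1) (j : Fin 3) :
    eval (chartParams T z) (chartZero i j) = z j := by
  unfold chartZero
  split_ifs with h
  · rw [map_one, h, hzi]
  · rw [eval_X]
    rfl

theorem eval_chartField {T : Matrix (Fin 3) (Fin 6) ℂ} {z : Fin 3 → ℂ} (hzi : z i = 1)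
    (hz : T *ᵥ veronese z = 0) (q : Fin 3 × Fin 6) :
    eval (chartParams T z) (chartField i q) = T q.1 q.2 := by
  unfold chartField
  split_ifs with h
  · have hsum : ∑ J, T q.1 J * veronese z J = 0 := congrFun hz q.1
    have hver : ∀ J, eval (chartParams T z) (veronese (chartZero i) J) = veronese z J := fun J => by
      rw [map_veronese]
      exact congrArg (veronese · J) (funext (eval_chartZero T hzi))
    have hone : veronese z (firstThree i) = 1 := by
      rw [veronese, quadIdx_firstThree, hzi, mul_one]
    rw [Fintype.sum_eq_add_sum_subtype_ne _ (firstThree i), hone, mul_one] at hsum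
    simp only [map_neg, map_sum, map_mul, eval_X, hver]
    rw [h]
    exact (eq_neg_of_add_eq_zero_left hsum).symm
  · rw [eval_X]
    rfl

theorem genericallyMatrix_chart (i : Fin 3) :
    GenericallyMatrix fun T => ∀ z : Fin 3 → ℂ, z i = 1 → T *ᵥ veronese z ≠ 0 := by
  obtain ⟨F, hF0, hF⟩ :=
    exists_mvPolynomial_ne_zero_aeval_eq_zero (card_chartVar_lt i) (chartField i)
  refine ⟨F, hF0, fun T hT z hzi hz => hT ?_⟩
  rw [← funext (eval_chartField hzi hz)]
  calc eval (fun q => eval (chartParams T z) (chartField i q)) F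
      = aeval (chartParams T z) (aeval (chartField i) F) :=
        (comp_aeval_apply (chartField i) (aeval (chartParams T z)) F).symm
    _ = 0 := by rw [hF, map_zero]

theorem genericallyMatrix_mulVec_veronese_ne_zero :
    GenericallyMatrix fun T => ∀ z, z ≠ 0 → T *ᵥ veronese z ≠ 0 := by
  obtain ⟨F, hF0, hF⟩ := (genericallyMatrix_chart 0).and <|
    (genericallyMatrix_chart 1).and (genericallyMatrix_chart 2)
  refine ⟨F, hF0, fun T hT z hz0 hz => ?_⟩
  obtain ⟨i, hi⟩ := Function.ne_iff.1 hz0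
  have hchart : ∀ i, ∀ z : Fin 3 → ℂ, z i = 1 → T *ᵥ veronese z ≠ 0 := by
    obtain ⟨h0, h1, h2⟩ := hF T hT
    exact Fin.forall_fin_succ.2 ⟨h0, Fin.forall_fin_two.2 ⟨h1, h2⟩⟩
  refine hchart i ((z i)⁻¹ • z) (inv_mul_cancel₀ hi) ?_
  rw [veronese_smul, mulVec_smul, hz, smul_zero]

end VanishingLocus

section SevenPoints

/-- The polynomials in the coefficients of a field. -/
abbrev FieldRing : Type := MvPolynomial (Fin 3 × Fin 6) ℂ

/-- The evaluation of polynomials in the coefficients at a field. -/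
def fieldEval (T : Matrix (Fin 3) (Fin 6) ℂ) : FieldRing →ₐ[ℂ] ℂ :=
  aeval fun q => T q.1 q.2

/-- The equations of the fixed points of the generic field. -/
def fixedEq (i : Fin 3) : MvPolynomial (Fin 3) FieldRing :=
  X i - quadPoly fun J => X (i, J)

/-- The equations expressing that each of seven points is fixed by the generic field, the variable
`(i, k)` being the `i`-th coordinate of the `k`-th point. -/
def sevenFixedEq (q : Fin 3 × Fin 7) : MvPolynomial (Fin 3 × Fin 7) FieldRing :=
  rename (fun j => (j, q.2)) (fixedEq q.1)

/-- A linear form that takes the values `0, …, 7` at the vertices of the unit cube. -/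
def cubeForm {S : Type*} [CommRing S] (z : Fin 3 → S) : S :=
  z 0 + 2 * z 1 + 4 * z 2

theorem cubeForm_zero {S : Type*} [CommRing S] : cubeForm (0 : Fin 3 → S) = 0 := by
  simp [cubeForm]

/-- A polynomial that vanishes unless the seven points are simple, and the origin and these points
are separated by `cubeForm`. -/
def sevenOpen : MvPolynomial (Fin 3 × Fin 7) FieldRing :=
  (Matrix.of fun q r => pderiv q (sevenFixedEq r)).det *
    (vandermonde (Fin.cons 0 fun k => cubeForm fun i => X (i, k) : Fin 8 → _)).det

variable (T : Matrix (Fin 3) (Fin 6) ℂ) (y : Fin 3 × Fin 7 → ℂ)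

theorem map_quadPoly {S S' : Type*} [CommRing S] [CommRing S'] (φ : S →+* S') (c : Fin 6 → S) :
    map φ (quadPoly c) = quadPoly fun J => φ (c J) := by
  simp only [quadPoly, map_sum, map_monomial]

theorem map_fixedEq (i : Fin 3) :
    map (fieldEval T : FieldRing →+* ℂ) (fixedEq i) = X i - quadPoly (T i) := by
  simp only [fixedEq, map_sub, map_X, map_quadPoly, fieldEval, RingHom.coe_coe, aeval_X]

theorem eval₂_rename_fixedEq (k : Fin 7) (Q : MvPolynomial (Fin 3) FieldRing) :
    eval₂ (fieldEval T : FieldRing →+* ℂ) y (rename (fun j => (j, k)) Q) =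
      eval (fun j => y (j, k)) (map (fieldEval T : FieldRing →+* ℂ) Q) := by
  rw [eval₂_rename, eval_map]
  rfl

theorem eval₂_sevenFixedEq (q : Fin 3 × Fin 7) :
    eval₂ (fieldEval T : FieldRing →+* ℂ) y (sevenFixedEq q) =
      y q - (T *ᵥ veronese fun j => y (j, q.2)) q.1 := by
  rw [sevenFixedEq, eval₂_rename_fixedEq, map_fixedEq, map_sub, eval_X, eval_quadPoly]
  rfl

theorem eval₂_pderiv_sevenFixedEq :
    (Matrix.of fun q r => eval₂ (fieldEval T : FieldRing →+* ℂ) y (pderiv q (sevenFixedEq r))) =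
      (blockDiagonal fun k => 1 - T * dVeronese fun j => y (j, k))ᵀ := by
  ext ⟨j, l⟩ ⟨i, k⟩
  rw [Matrix.of_apply, transpose_apply, blockDiagonal_apply, sevenFixedEq]
  split_ifs with h
  · obtain rfl : k = l := h
    rw [pderiv_rename (f := fun j => (j, k)) (Prod.mk_left_injective k), eval₂_rename_fixedEq,
      ← pderiv_map, map_fixedEq, map_sub, map_sub, eval_pderiv_quadPoly, pderiv_X,
      Matrix.sub_apply, one_apply, Pi.single_apply, apply_ite (eval _), map_one, map_zero]
    rfl
  · rw [pderiv_eq_zero_of_notMem_vars, eval₂_zero]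
    intro hmem
    obtain ⟨i', _, h'⟩ := Finset.mem_image.1 (vars_rename _ _ hmem)
    exact h (Prod.mk.inj h').2

theorem eval₂_sevenOpen :
    eval₂ (fieldEval T : FieldRing →+* ℂ) y sevenOpen =
      (∏ k, (1 - T * dVeronese fun j => y (j, k)).det) *
        (vandermonde (Fin.cons 0 fun k => cubeForm fun i => y (i, k) : Fin 8 → _)).det := by
  rw [sevenOpen, eval₂_mul, ← coe_eval₂Hom, RingHom.map_det, RingHom.map_det]
  congr 1
  · rw [← det_blockDiagonal, ← det_transpose (blockDiagonal _), ← eval₂_pderiv_sevenFixedEq]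
    rfl
  · congr 1
    ext a b
    simp only [RingHom.mapMatrix_apply, Matrix.map_apply, vandermonde_apply, map_pow]
    congr 1
    refine Fin.cases (map_zero _) (fun k => ?_) a
    simp [cubeForm, Fin.cons_succ]

/-- The field `∑ z_i² ∂/∂z_i`, whose fixed points are the vertices of the unit cube. -/
def cubeField : Matrix (Fin 3) (Fin 6) ℂ :=
  (1 : Matrix (Fin 6) (Fin 6) ℂ).submatrix firstThree id

/-- The nonzero vertices of the unit cube, as binary expansions. -/
def cubePoint : Fin 7 → Fin 3 → ℂ :=
  ![![1, 0, 0], ![0, 1, 0], ![1, 1, 0], ![0, 0, 1], ![1, 0, 1], ![0, 1, 1], ![1, 1, 1]]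

theorem cubeField_mulVec (v : Fin 6 → ℂ) : cubeField *ᵥ v = v ∘ firstThree := by
  rw [cubeField, ← Equiv.coe_refl, submatrix_mulVec_equiv, one_mulVec]
  rfl

theorem cubeField_mul_dVeronese (z : Fin 3 → ℂ) :
    cubeField * dVeronese z = diagonal fun i => 2 * z i := by
  rw [cubeField, ← Equiv.coe_refl, one_submatrix_mul]
  ext i j
  rw [submatrix_apply, Function.comp_apply, Equiv.refl_symm, Equiv.refl_apply, dVeronese,
    of_apply, quadIdx_firstThree, diagonal_apply]
  simp only [eq_comm (a := j), id_eq, two_mul]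
  split_ifs
  · rfl
  · exact add_zero 0

theorem cubePoint_eq_zero_or_one (k : Fin 7) (i : Fin 3) :
    cubePoint k i = 0 ∨ cubePoint k i = 1 := by
  fin_cases k <;> fin_cases i <;> simp [cubePoint]

theorem cubeForm_cubePoint (k : Fin 7) : cubeForm (cubePoint k) = (k : ℕ) + 1 := by
  fin_cases k <;> simp [cubePoint, cubeForm] <;> norm_num

theorem isSimpleFixedPoint_cubePoint (k : Fin 7) : IsSimpleFixedPoint cubeField (cubePoint k) := by
  refine ⟨fun h => ?_, ?_, ?_⟩
  · have := cubeForm_cubePoint k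
    rw [h, cubeForm_zero] at this
    exact Nat.cast_add_one_ne_zero _ this.symm
  · rw [cubeField_mulVec]
    ext i
    rw [Function.comp_apply, veronese, quadIdx_firstThree]
    rcases cubePoint_eq_zero_or_one k i with h | h <;> rw [h] <;> norm_num
  · rw [cubeField_mul_dVeronese, ← diagonal_one, diagonal_sub, det_diagonal,
      Finset.prod_ne_zero_iff]
    intro i _
    rcases cubePoint_eq_zero_or_one k i with h | h <;> rw [h] <;> norm_num

theorem genericallyMatrix_exists_isSimpleFixedPoint :
    GenericallyMatrix fun T => ∃ p : Fin 7 → Fin 3 → ℂ, Function.Injective p ∧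
      ∀ k, IsSimpleFixedPoint T (p k) := by
  have hcube := isSimpleFixedPoint_cubePoint
  have hprod : ∏ k, (1 - cubeField * dVeronese (cubePoint k)).det ≠ 0 :=
    Finset.prod_ne_zero_iff.2 fun k _ => (hcube k).det_ne_zero
  have hvan : (vandermonde (Fin.cons 0 fun k => cubeForm (cubePoint k) : Fin 8 → _)).det ≠ 0 := by
    have h : (Fin.cons 0 fun k => cubeForm (cubePoint k) : Fin 8 → ℂ) =
        fun k : Fin 8 => ((k : ℕ) : ℂ) := by
      ext a
      refine Fin.cases (by simp) (fun k => ?_) a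
      simp [cubeForm_cubePoint]
    rw [h]
    exact det_vandermonde_ne_zero_iff.2 (Nat.cast_injective.comp Fin.val_injective)
  obtain ⟨F, hF0, hF⟩ := exists_forall_exists_zero (H := sevenFixedEq) (G := sevenOpen)
    (fieldEval cubeField) (fun q => cubePoint q.2 q.1)
    (fun q => by
      rw [eval₂_sevenFixedEq, sub_eq_zero]
      exact congrFun (hcube q.2).fixed.symm q.1)
    (by
      rw [eval₂_sevenOpen]
      exact mul_ne_zero hprod hvan)
    (by
      rw [eval₂_pderiv_sevenFixedEq, det_transpose, det_blockDiagonal]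
      exact hprod)
  refine ⟨F, fun h => hF0 (by rw [h, map_zero]), fun T hT => ?_⟩
  obtain ⟨y, hy, hyG⟩ := hF (fieldEval T) hT
  rw [eval₂_sevenOpen, mul_ne_zero_iff, Finset.prod_ne_zero_iff, det_vandermonde_ne_zero_iff] at hyG
  obtain ⟨hdet, hinj⟩ := hyG
  refine ⟨fun k i => y (i, k), fun k l hkl => ?_, fun k =>
    ⟨fun h => ?_, ?_, hdet k (Finset.mem_univ k)⟩⟩
  · refine Fin.succ_injective _ (hinj ?_)
    exact congrArg cubeForm hkl
  · refine Fin.succ_ne_zero k (hinj ?_)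
    rw [Fin.cons_succ, Fin.cons_zero]
    exact (congrArg cubeForm h).trans cubeForm_zero
  · ext i
    have := hy (i, k)
    rw [eval₂_sevenFixedEq, sub_eq_zero] at this
    exact this.symm

end SevenPoints

section Derivation

variable {k A K : Type*} [CommRing k] [CommRing A] [Algebra k A] [CommRing K] [Algebra A K]
  [Algebra k K] (D : Derivation k A K)

theorem derivation_matrix_mul {m n l : Type*} [Fintype n] (T : Matrix m n A) (U : Matrix n l A) :
    (T * U).map D = T.map D * U.map (algebraMap A K) + T.map (algebraMap A K) * U.map D := by
  ext i j
  simp only [map_apply, mul_apply, Matrix.add_apply, map_sum, Derivation.leibniz,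
    Algebra.smul_def, ← Finset.sum_add_distrib]
  refine Finset.sum_congr rfl fun r _ => ?_
  ring

theorem derivation_dVeronese (z : Fin 3 → A) : (dVeronese z).map D = dVeronese (D ∘ z) := by
  ext J j
  simp only [dVeronese, map_apply, of_apply, map_add, apply_ite D, map_zero, Function.comp_apply]

theorem derivation_mul_dVeronese (T : Matrix (Fin 3) (Fin 6) A) (z : Fin 3 → A) :
    (T * dVeronese z).map D = T.map D * dVeronese (algebraMap A K ∘ z) +
      T.map (algebraMap A K) * dVeronese (D ∘ z) := by
  rw [derivation_matrix_mul, derivation_dVeronese, map_dVeronese]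

theorem derivation_mulVec_veronese (T : Matrix (Fin 3) (Fin 6) A) (z : Fin 3 → A) :
    D ∘ (T *ᵥ veronese z) = T.map D *ᵥ veronese (algebraMap A K ∘ z) +
      (T.map (algebraMap A K) * dVeronese (algebraMap A K ∘ z)) *ᵥ (D ∘ z) := by
  have hver : ∀ J, D (veronese z J) = (dVeronese (algebraMap A K ∘ z) *ᵥ (D ∘ z)) J := fun J => by
    rw [dVeronese_mulVec]
    simp only [veronese, Derivation.leibniz, Algebra.smul_def, Function.comp_apply]
    ring
  ext i
  rw [← mulVec_mulVec]
  simp only [Function.comp_apply, Pi.add_apply, mulVec, dotProduct, map_sum, Derivation.leibniz,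
    Algebra.smul_def, map_apply, ← Finset.sum_add_distrib]
  refine Finset.sum_congr rfl fun J _ => ?_
  rw [hver, map_veronese]
  simp only [mulVec, dotProduct, Function.comp_def]
  ring

theorem derivation_det_fin_three (N : Matrix (Fin 3) (Fin 3) A) :
    D N.det = (adjugate (N.map (algebraMap A K)) * N.map D).trace := by
  simp only [det_fin_three, adjugate_fin_three, trace_fin_three, mul_apply, Fin.sum_univ_three,
    map_add, map_sub, Derivation.leibniz, Algebra.smul_def, map_apply, map_mul, of_apply, cons_val]
  ring

end Derivation

section BaseField

/-- Six fixed points of the field `x(x+2z), y(y+2x), z(z+2y)`. -/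
def basePoints : Fin 6 → Fin 3 → ℂ :=
  ![![1, 0, 0], ![0, 1, 0], ![0, 0, 1], ![0, 1, -1], ![-1, 0, 1], ![1, -1, 0]]

/-- The coefficients of the field `x(x+2z), y(y+2x), z(z+2y)`. -/
def baseField : Matrix (Fin 3) (Fin 6) ℂ :=
  !![1, 0, 0, 0, 2, 0; 0, 1, 0, 0, 0, 2; 0, 0, 1, 2, 0, 0]

theorem veronese_eq {S : Type*} [CommRing S] (z : Fin 3 → S) :
    veronese z = ![z 0 * z 0, z 1 * z 1, z 2 * z 2, z 1 * z 2, z 0 * z 2, z 0 * z 1] := by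
  ext J
  fin_cases J <;> rfl

theorem baseField_mulVec_veronese (k : Fin 6) :
    baseField *ᵥ veronese (basePoints k) = basePoints k := by
  ext i
  fin_cases k <;> fin_cases i <;>
    simp [baseField, basePoints, veronese_eq, mulVec, dotProduct, Fin.sum_univ_six] <;> norm_num

theorem dVeronese_eq {S : Type*} [CommRing S] (z : Fin 3 → S) : dVeronese z =
    !![2 * z 0, 0, 0; 0, 2 * z 1, 0; 0, 0, 2 * z 2; 0, z 2, z 1; z 2, 0, z 0; z 1, z 0, 0] := by
  ext J j
  fin_cases J <;> fin_cases j <;> simp [dVeronese, quadIdx, two_mul]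

theorem baseField_mul_dVeronese (z : Fin 3 → ℂ) : baseField * dVeronese z =
    !![2 * (z 0 + z 2), 0, 2 * z 0; 2 * z 1, 2 * (z 1 + z 0), 0; 0, 2 * z 2, 2 * (z 2 + z 1)] := by
  rw [dVeronese_eq]
  ext i j
  fin_cases i <;> fin_cases j <;> simp [baseField, mul_apply, Fin.sum_univ_six] <;> ring

theorem det_one_sub_base_ne_zero (k : Fin 6) :
    (1 - baseField * dVeronese (basePoints k)).det ≠ 0 := by
  rw [baseField_mul_dVeronese, det_fin_three]
  fin_cases k <;> simp [basePoints] <;> norm_num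

theorem det_veroneseMatrix_basePoints : (veroneseMatrix basePoints).det ≠ 0 := by
  have hlower : (veroneseMatrix basePoints).IsLowerTriangular := fun k J hkJ => by
    fin_cases k <;> fin_cases J <;> first
      | exact absurd hkJ (by decide)
      | simp [veroneseMatrix, veronese_eq, basePoints]
  rw [det_of_isLowerTriangular _ hlower]
  simp [veroneseMatrix, veronese_eq, basePoints, Fin.prod_univ_succ]

theorem basePoints_firstThree (j : Fin 3) : basePoints (firstThree j) = Pi.single j 1 := by
  ext i
  fin_cases j <;> fin_cases i <;> rfl

theorem veronese_single (j : Fin 3) :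
    veronese (Pi.single j 1 : Fin 3 → ℂ) = Pi.single (firstThree j) 1 := by
  ext J
  fin_cases j <;> fin_cases J <;> simp [veronese_eq, firstThree] <;> rfl

variable {T : Matrix (Fin 3) (Fin 6) ℂ}

/-- At the first three base points, the traces of `M` and the determinants of `1 - M` have linearly
independent differentials. -/
theorem eq_of_traces_of_dets (hsq : ∀ i j, T i (firstThree j) = 0)
    (htr : ∀ k, (T * dVeronese (basePoints (firstThree k))).trace = 0)
    (hdet : ∀ k, ((1 - baseField * dVeronese (basePoints (firstThree k))).adjugate *
      (T * dVeronese (basePoints (firstThree k)))).trace = 0) :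
    T = !![0, 0, 0, T 0 3, 0, 0; 0, 0, 0, 0, T 1 4, 0; 0, 0, 0, 0, 0, T 2 5] := by
  have hsq0 : ∀ i, T i 0 = 0 := fun i => hsq i 0
  have hsq1 : ∀ i, T i 1 = 0 := fun i => hsq i 1
  have hsq2 : ∀ i, T i 2 = 0 := fun i => hsq i 2
  have htr' : T 1 5 + T 2 4 = 0 ∧ T 0 5 + T 2 3 = 0 ∧ T 0 4 + T 1 3 = 0 := by
    simpa [basePoints_firstThree, dVeronese_eq, Fin.forall_fin_succ, trace_fin_three, mul_apply,
      Fin.sum_univ_six, hsq0, hsq1, hsq2] using htr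
  have hdet' : (1 - 2) * T 1 5 + (1 - 2) * (1 - 2) * T 2 4 = 0 ∧
      (1 - 2) * (1 - 2) * T 0 5 + (1 - 2) * T 2 3 = 0 ∧
      (1 - 2) * T 0 4 + (1 - 2) * (1 - 2) * T 1 3 = 0 := by
    simp only [baseField_mul_dVeronese] at hdet
    simp only [basePoints_firstThree, dVeronese_eq, Fin.forall_fin_succ, trace_fin_three, mul_apply,
      Fin.sum_univ_six, Fin.sum_univ_three, adjugate_fin_three, hsq0, hsq1, hsq2] at hdet
    simpa using hdet
  ext i J
  fin_cases i <;> fin_cases J <;> simp <;> grind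

theorem eq_zero_of_fixed_of_trace (hT : T =
      !![0, 0, 0, T 0 3, 0, 0; 0, 0, 0, 0, T 1 4, 0; 0, 0, 0, 0, 0, T 2 5])
    {p : Fin 6 → Fin 3 → ℂ} (hfix : ∀ k, T *ᵥ veronese (basePoints k) +
      (baseField * dVeronese (basePoints k)) *ᵥ p k = p k)
    (hp : ∀ i, p (firstThree i) = 0)
    (htr : ∀ k, (T * dVeronese (basePoints k) + baseField * dVeronese (p k)).trace = 0) :
    p = 0 := by
  have hp0 : p 0 = 0 := hp 0
  have hp1 : p 1 = 0 := hp 1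
  have hp2 : p 2 = 0 := hp 2
  rw [hT] at hfix htr
  simp only [baseField_mul_dVeronese] at hfix htr
  simp only [dVeronese_eq, veronese_eq] at hfix htr
  have hsum : ∀ k, p k 0 + p k 1 + p k 2 = 0 := fun k => by
    have h : 2 * (p k 0 + p k 2) + 2 * (p k 1 + p k 0) + 2 * (p k 2 + p k 1) = 0 := by
      simpa [basePoints, dotProduct, Fin.sum_univ_succ, trace_fin_three] using htr k
    linear_combination h / 4
  have hfix3 : 2 * p 3 0 + 2 * p 3 1 = p 3 1 ∧ -(2 * p 3 1) = p 3 2 := by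
    constructor
    · simpa [basePoints, dotProduct, Fin.sum_univ_succ] using congrFun (hfix 3) 1
    · simpa [basePoints, dotProduct, Fin.sum_univ_succ] using congrFun (hfix 3) 2
  have hfix4 : 2 * p 4 1 + 2 * p 4 2 = p 4 2 ∧ -(2 * p 4 2) = p 4 0 := by
    constructor
    · simpa [basePoints, dotProduct, Fin.sum_univ_succ] using congrFun (hfix 4) 2
    · simpa [basePoints, dotProduct, Fin.sum_univ_succ] using congrFun (hfix 4) 0
  have hfix5 : 2 * p 5 0 + 2 * p 5 2 = p 5 0 ∧ -(2 * p 5 0) = p 5 1 := by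
    constructor
    · simpa [basePoints, dotProduct, Fin.sum_univ_succ] using congrFun (hfix 5) 0
    · simpa [basePoints, dotProduct, Fin.sum_univ_succ] using congrFun (hfix 5) 1
  ext k i
  fin_cases k <;> fin_cases i <;> simp [hp0, hp1, hp2] <;> grind

theorem eq_zero_of_variation_baseField {p : Fin 6 → Fin 3 → ℂ}
    (hfix : ∀ k, T *ᵥ veronese (basePoints k) +
      (baseField * dVeronese (basePoints k)) *ᵥ p k = p k)
    (hp : ∀ i, p (firstThree i) = 0)
    (htr : ∀ k, (T * dVeronese (basePoints k) + baseField * dVeronese (p k)).trace = 0)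
    (hdet : ∀ k, ((1 - baseField * dVeronese (basePoints (firstThree k))).adjugate *
      (T * dVeronese (basePoints (firstThree k)))).trace = 0) : p = 0 := by
  have hsq : ∀ i j, T i (firstThree j) = 0 := fun i j => by
    have h := congrFun (hfix (firstThree j)) i
    rwa [hp, mulVec_zero, add_zero, basePoints_firstThree, veronese_single,
      mulVec_single_one] at h
  refine eq_zero_of_fixed_of_trace (eq_of_traces_of_dets hsq (fun k => ?_) hdet) hfix hp htr
  have h := htr (firstThree k)
  rwa [hp, show baseField * dVeronese (0 : Fin 3 → ℂ) = 0 from map_zero (jacobianMap baseField),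
    add_zero] at h

end BaseField

section ConfigurationRing

/-- The points of the universal configuration of six points, with indeterminate coordinates. -/
def confVar (k : Fin 6) (i : Fin 3) : MvPolynomial (Fin 6 × Fin 3) ℂ :=
  X (k, i)

/-- The polynomial in the coordinates of six points that vanishes when they lie on a conic. -/
def confDet : MvPolynomial (Fin 6 × Fin 3) ℂ :=
  (veroneseMatrix confVar).det

theorem map_det_veroneseMatrix {A B : Type*} [CommRing A] [CommRing B] (φ : A →+* B)
    (y : Fin 6 → Fin 3 → A) :
    φ (veroneseMatrix y).det = (veroneseMatrix fun k => φ ∘ y k).det := by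
  rw [RingHom.map_det]
  congr 1
  ext k J
  exact map_veronese φ (y k) J

theorem aeval_confDet {A : Type*} [CommRing A] [Algebra ℂ A] (y : Fin 6 → Fin 3 → A) :
    aeval (fun q : Fin 6 × Fin 3 => y q.1 q.2) confDet = (veroneseMatrix y).det := by
  refine (map_det_veroneseMatrix (aeval fun q : Fin 6 × Fin 3 => y q.1 q.2).toRingHom
    confVar).trans ?_
  congr
  ext k i
  exact aeval_X _ (k, i)

theorem confDet_ne_zero : confDet ≠ 0 := fun h =>
  det_veroneseMatrix_basePoints <| by rw [← aeval_confDet, h, map_zero]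

/-- The ring of regular functions on the configurations of six points not lying on a conic. -/
abbrev ConfRing : Type := Localization.Away confDet

instance : IsDomain ConfRing :=
  IsLocalization.isDomain_localization
    (powers_le_nonZeroDivisors_of_noZeroDivisors confDet_ne_zero)

instance : Algebra.FiniteType ℂ ConfRing :=
  haveI : Algebra.FinitePresentation (MvPolynomial (Fin 6 × Fin 3) ℂ) ConfRing :=
    IsLocalization.Away.finitePresentation confDet
  Algebra.FiniteType.trans (S := MvPolynomial (Fin 6 × Fin 3) ℂ) inferInstance inferInstance

/-- The points of the universal configuration of six points not lying on a conic. -/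
def confPoint (k : Fin 6) (i : Fin 3) : ConfRing :=
  algebraMap (MvPolynomial (Fin 6 × Fin 3) ℂ) ConfRing (confVar k i)

theorem isUnit_det_confPoint : IsUnit (veroneseMatrix confPoint).det := by
  rw [show (veroneseMatrix confPoint).det = algebraMap _ ConfRing confDet from
    (map_det_veroneseMatrix (algebraMap _ ConfRing) confVar).symm]
  exact IsLocalization.Away.algebraMap_isUnit confDet

/-- The field of which six given points not lying on a conic are fixed points. -/
def interpolant {S : Type*} [CommRing S] (y : Fin 6 → Fin 3 → S) : Matrix (Fin 3) (Fin 6) S :=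
  (of fun i k => y k i) * (veroneseMatrix y)ᵀ⁻¹

theorem forall_mulVec_veronese_eq_iff {S : Type*} [CommRing S] {y : Fin 6 → Fin 3 → S}
    (hy : IsUnit (veroneseMatrix y).det) (T : Matrix (Fin 3) (Fin 6) S) :
    (∀ k, T *ᵥ veronese (y k) = y k) ↔ T = interpolant y := by
  have hunit : IsUnit (veroneseMatrix y)ᵀ.det := by rwa [det_transpose]
  have hmul : (∀ k, T *ᵥ veronese (y k) = y k) ↔
      T * (veroneseMatrix y)ᵀ = of fun i k => y k i :=
    ⟨fun h => Matrix.ext fun i k => congrFun (h k) i,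
      fun h k => _root_.funext fun i => congrFun (congrFun h i) k⟩
  refine hmul.trans ⟨fun h => ?_, fun h => ?_⟩
  · rw [interpolant, ← h, mul_nonsing_inv_cancel_right _ _ hunit]
  · rw [h, interpolant, nonsing_inv_mul_cancel_right _ _ hunit]

/-- The field of which the points of the universal configuration are fixed points. -/
def confField : Matrix (Fin 3) (Fin 6) ConfRing :=
  interpolant confPoint

theorem confField_mulVec_veronese (k : Fin 6) :
    confField *ᵥ veronese (confPoint k) = confPoint k :=
  (forall_mulVec_veronese_eq_iff isUnit_det_confPoint _).2 rfl k

theorem isUnit_aeval_of_mem_powers {y : Fin 6 → Fin 3 → ℂ} (hy : (veroneseMatrix y).det ≠ 0)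
    (r : Submonoid.powers confDet) :
    IsUnit (aeval (fun q : Fin 6 × Fin 3 => y q.1 q.2) (r : MvPolynomial (Fin 6 × Fin 3) ℂ)) := by
  obtain ⟨r, n, rfl⟩ := r
  simp only [map_pow, aeval_confDet]
  exact (isUnit_iff_ne_zero.2 hy).pow n

/-- The evaluation of regular functions at a configuration of six points not lying on a conic. -/
def confEval (y : Fin 6 → Fin 3 → ℂ) (hy : (veroneseMatrix y).det ≠ 0) : ConfRing →ₐ[ℂ] ℂ :=
  IsLocalization.liftAlgHom (M := Submonoid.powers confDet) (isUnit_aeval_of_mem_powers hy)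

theorem derivation_confRing_eq_zero {M : Type*} [AddCommGroup M] [Module ConfRing M] [Module ℂ M]
    {D : Derivation ℂ ConfRing M} (h : ∀ k i, D (confPoint k i) = 0) : D = 0 := by
  have hpoly : ∀ r, D (algebraMap (MvPolynomial (Fin 6 × Fin 3) ℂ) ConfRing r) = 0 := fun r => by
    induction r using MvPolynomial.induction_on with
    | C a => exact D.map_algebraMap a
    | add p q hp hq => rw [map_add, map_add, hp, hq, add_zero]
    | mul_X p q hp =>
      rw [map_mul, Derivation.leibniz, hp, smul_zero, add_zero,
        show D (algebraMap _ ConfRing (X q)) = 0 from h q.1 q.2, smul_zero]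
  ext x
  obtain ⟨⟨r, s⟩, hx⟩ := IsLocalization.surj (Submonoid.powers confDet) x
  have hD := congrArg D hx
  rw [Derivation.leibniz, hpoly, hpoly, smul_zero, zero_add] at hD
  exact (IsLocalization.map_units ConfRing s).smul_eq_zero.1 hD

section Evaluation

variable {T : Matrix (Fin 3) (Fin 6) ℂ} {y : Fin 6 → Fin 3 → ℂ} (hy : (veroneseMatrix y).det ≠ 0)

theorem confEval_comp_confPoint (k : Fin 6) : confEval y hy ∘ confPoint k = y k := by
  ext i
  rw [Function.comp_apply, confEval, IsLocalization.liftAlgHom_apply, confPoint,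
    IsLocalization.lift_eq]
  exact aeval_X _ (k, i)

variable (hT : ∀ k, T *ᵥ veronese (y k) = y k)
include hT

theorem map_confField_of_fixed : confField.map (confEval y hy) = T := by
  have hunit := isUnit_iff_ne_zero.2 hy
  rw [(forall_mulVec_veronese_eq_iff hunit T).1 hT, ← forall_mulVec_veronese_eq_iff hunit]
  intro k
  have hver : veronese (y k) = confEval y hy ∘ veronese (confPoint k) := by
    ext J
    rw [← confEval_comp_confPoint hy k]
    exact (map_veronese (confEval y hy).toRingHom (confPoint k) J).symm
  calc confField.map (confEval y hy) *ᵥ veronese (y k)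
      = confEval y hy ∘ (confField *ᵥ veronese (confPoint k)) := by
        rw [hver]
        ext i
        exact ((confEval y hy : ConfRing →+* ℂ).map_mulVec _ _ i).symm
    _ = y k := by rw [confField_mulVec_veronese, confEval_comp_confPoint]

theorem map_confField_mul_dVeronese (k : Fin 6) :
    (confField * dVeronese (confPoint k)).map (confEval y hy) = T * dVeronese (y k) := by
  have h : (dVeronese (confPoint k)).map (confEval y hy) = dVeronese (y k) := by
    rw [← confEval_comp_confPoint hy k]
    exact map_dVeronese (confEval y hy : ConfRing →+* ℂ) (confPoint k)
  rw [← h, ← map_confField_of_fixed hy hT]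
  exact Matrix.map_mul (f := (confEval y hy : ConfRing →+* ℂ))

theorem confEval_trace (k : Fin 6) :
    confEval y hy (confField * dVeronese (confPoint k)).trace = (T * dVeronese (y k)).trace := by
  rw [← map_confField_mul_dVeronese hy hT k]
  exact AddMonoidHom.map_trace (confEval y hy) _

theorem confEval_det (k : Fin 6) :
    confEval y hy (1 - confField * dVeronese (confPoint k)).det =
      (1 - T * dVeronese (y k)).det := by
  rw [← map_confField_mul_dVeronese hy hT k, AlgHom.map_det, map_sub, map_one]
  rfl

end Evaluation

/-- The functions of a configuration that the exponents and the first three points determine. -/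
def exponentData : Set ConfRing :=
  Set.range (fun q : Fin 3 × Fin 3 => confPoint (firstThree q.1) q.2) ∪
    (Set.range (fun k : Fin 6 => (confField * dVeronese (confPoint k)).trace) ∪
    Set.range fun k : Fin 3 => (1 - confField * dVeronese (confPoint (firstThree k))).det)

section BaseConfiguration

/-- Evaluation at the base configuration makes `ℂ` an algebra over the regular functions, so that
the derivations `ConfRing → ℂ` are its tangent vectors. -/
local instance baseAlgebra : Algebra ConfRing ℂ :=
  (confEval basePoints det_veroneseMatrix_basePoints).toRingHom.toAlgebra

local instance isScalarTower_baseAlgebra : IsScalarTower ℂ ConfRing ℂ :=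
  .of_algHom (confEval basePoints det_veroneseMatrix_basePoints)

variable (D : Derivation ℂ ConfRing ℂ)

theorem algebraMap_comp_confPoint (k : Fin 6) :
    algebraMap ConfRing ℂ ∘ confPoint k = basePoints k :=
  confEval_comp_confPoint _ k

theorem map_algebraMap_confField : confField.map (algebraMap ConfRing ℂ) = baseField :=
  map_confField_of_fixed _ baseField_mulVec_veronese

theorem derivation_confField_mul_dVeronese (k : Fin 6) :
    (confField * dVeronese (confPoint k)).map D =
      confField.map D * dVeronese (basePoints k) + baseField * dVeronese (D ∘ confPoint k) := by
  rw [derivation_mul_dVeronese, algebraMap_comp_confPoint, map_algebraMap_confField]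

theorem derivation_confPoint (k : Fin 6) :
    confField.map D *ᵥ veronese (basePoints k) +
      (baseField * dVeronese (basePoints k)) *ᵥ (D ∘ confPoint k) = D ∘ confPoint k := by
  rw [← algebraMap_comp_confPoint, ← map_algebraMap_confField, ← derivation_mulVec_veronese,
    confField_mulVec_veronese]

theorem derivation_det_confField (k : Fin 6) :
    D (1 - confField * dVeronese (confPoint k)).det =
      -((1 - baseField * dVeronese (basePoints k)).adjugate *
        (confField * dVeronese (confPoint k)).map D).trace := by
  have hmap : (1 - confField * dVeronese (confPoint k)).map (algebraMap ConfRing ℂ) =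
      1 - baseField * dVeronese (basePoints k) := by
    rw [← map_algebraMap_confField, ← algebraMap_comp_confPoint, ← map_dVeronese,
      ← Matrix.map_mul, Matrix.map_sub _ (map_sub _), Matrix.map_one _ (map_zero _) (map_one _)]
  have hD : (1 - confField * dVeronese (confPoint k)).map D =
      -(confField * dVeronese (confPoint k)).map D := by
    ext i j
    simp only [map_apply, Matrix.sub_apply, map_sub, one_apply, apply_ite D,
      Derivation.map_one_eq_zero, map_zero, ite_self, zero_sub, Matrix.neg_apply]
  rw [derivation_det_fin_three, hmap, hD, Matrix.mul_neg, trace_neg]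

theorem isAlgebraic_adjoin_exponentData :
    Algebra.IsAlgebraic (Algebra.adjoin ℂ exponentData) ConfRing := by
  refine isAlgebraic_adjoin_of_forall_derivation_eq_zero (F := ℂ) _ fun D hD => ?_
  have hp : ∀ i, D ∘ confPoint (firstThree i) = 0 := fun i => _root_.funext fun j =>
    hD _ (Or.inl ⟨(i, j), rfl⟩)
  have htr : ∀ k, ((confField * dVeronese (confPoint k)).map D).trace = 0 := fun k =>
    (AddMonoidHom.map_trace D _).symm.trans (hD _ (Or.inr (Or.inl ⟨k, rfl⟩)))
  have hdet : ∀ k, ((1 - baseField * dVeronese (basePoints (firstThree k))).adjugate *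
      (confField * dVeronese (confPoint (firstThree k))).map D).trace = 0 := fun k => by
    rw [← neg_eq_zero, ← derivation_det_confField]
    exact hD _ (Or.inr (Or.inr ⟨k, rfl⟩))
  simp only [derivation_confField_mul_dVeronese] at htr hdet
  have h := eq_zero_of_variation_baseField (derivation_confPoint D) hp htr fun k => by
    simpa [hp, show baseField * dVeronese (0 : Fin 3 → ℂ) = 0 from map_zero (jacobianMap baseField)]
      using hdet k
  exact derivation_confRing_eq_zero fun k i => congrFun (congrFun h k) i

theorem isAlgebraic_adjoin_confField : Algebra.IsAlgebraic
    (Algebra.adjoin ℂ (Set.range fun q : Fin 3 × Fin 6 => confField q.1 q.2)) ConfRing := by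
  refine isAlgebraic_adjoin_of_forall_derivation_eq_zero (F := ℂ) _ fun D hD => ?_
  have hfield : confField.map D = 0 := by
    ext i J
    exact hD _ ⟨(i, J), rfl⟩
  refine derivation_confRing_eq_zero fun k i => congrFun
    (eq_zero_of_mulVec_eq_zero (det_one_sub_base_ne_zero k) (v := D ∘ confPoint k) ?_) i
  have h := derivation_confPoint D k
  rw [hfield, zero_mulVec, zero_add] at h
  rw [sub_mulVec, one_mulVec, h, sub_self]

end BaseConfiguration

theorem exists_ne_zero_finite_configurations :
    ∃ c : ConfRing, c ≠ 0 ∧ ∀ φ : ConfRing →ₐ[ℂ] ℂ, φ c ≠ 0 →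
      {y : Fin 6 → Fin 3 → ℂ | ∃ ψ : ConfRing →ₐ[ℂ] ℂ,
        (∀ a ∈ exponentData, ψ a = φ a) ∧ ∀ k, ψ ∘ confPoint k = y k}.Finite := by
  choose c hc0 hc using fun q : Fin 6 × Fin 3 => exists_ne_zero_finite_specializations
    exponentData (confPoint q.1 q.2) (isAlgebraic_adjoin_exponentData.isAlgebraic _)
  refine ⟨∏ q, c q, Finset.prod_ne_zero_iff.2 fun q _ => hc0 q, fun φ hφ => ?_⟩
  have hq : ∀ q, φ (c q) ≠ 0 := fun q => by
    rw [map_prod] at hφ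
    exact Finset.prod_ne_zero_iff.1 hφ q (Finset.mem_univ q)
  refine (Set.Finite.pi' fun k => Set.Finite.pi' fun i => hc (k, i) φ (hq (k, i))).subset ?_
  rintro y ⟨ψ, hψ, hy⟩ k i
  exact ⟨ψ, hψ, congrFun (hy k) i⟩

theorem genericallyMatrix_confEval_ne_zero {G : ConfRing} (hG : G ≠ 0) :
    GenericallyMatrix fun T => ∀ (y : Fin 6 → Fin 3 → ℂ) (hy : (veroneseMatrix y).det ≠ 0),
      (∀ k, T *ᵥ veronese (y k) = y k) → confEval y hy G ≠ 0 := by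
  obtain ⟨F, hF0, hF⟩ := exists_mvPolynomial_ne_zero_forall_eval_eq_zero
    (fun q : Fin 3 × Fin 6 => confField q.1 q.2) (isAlgebraic_adjoin_confField.isAlgebraic G) hG
  refine ⟨F, hF0, fun T hT y hy hTy h => hT ?_⟩
  have hzero : eval (fun q => confEval y hy (confField q.1 q.2)) F = 0 := hF (confEval y hy) h
  rw [← map_confField_of_fixed hy hTy]
  exact hzero

theorem det_confPoint_firstThree_ne_zero :
    (of fun i => confPoint (firstThree i)).det ≠ 0 := fun h => by
  have heval : (of fun i => basePoints (firstThree i)).det = 0 := by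
    have hmap := congrArg (confEval basePoints det_veroneseMatrix_basePoints) h
    rw [AlgHom.map_det, map_zero] at hmap
    simp only [← confEval_comp_confPoint det_veroneseMatrix_basePoints]
    exact hmap
  have hone : (of fun i => basePoints (firstThree i)) = 1 := by
    ext i j
    rw [of_apply, basePoints_firstThree, Matrix.one_apply, Pi.single_apply]
    exact if_congr eq_comm rfl rfl
  rw [hone, det_one] at heval
  exact one_ne_zero heval

end ConfigurationRing

/-- The trace of the Jacobian matrix `M` of a field at a point and the determinant of `I - M`. At a
fixed point these determine the Kowalevski exponents, and conversely. -/
def exponentInvariants {S : Type*} [CommRing S] (T : Matrix (Fin 3) (Fin 6) S) (z : Fin 3 → S) :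
    S × S :=
  ((T * dVeronese z).trace, (1 - T * dVeronese z).det)

theorem IsSimpleFixedPoint.of_exponentInvariants_eq {K : Type*} [Field K]
    {T T' : Matrix (Fin 3) (Fin 6) K} {a a' : Fin 3 → K} (ha : IsSimpleFixedPoint T a)
    (hne : a' ≠ 0) (hfix : T' *ᵥ veronese a' = a')
    (hinv : exponentInvariants T' a' = exponentInvariants T a) : IsSimpleFixedPoint T' a' :=
  ⟨hne, hfix, (congrArg Prod.snd hinv).trans_ne ha.det_ne_zero⟩

section LinearChange

variable {S : Type*} [CommRing S]

theorem symSquare_mul_dVeronese (A : Matrix (Fin 3) (Fin 3) S) (z : Fin 3 → S) :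
    symSquare A * dVeronese z = dVeronese (A *ᵥ z) * A := by
  refine Matrix.ext_of_mulVec_single fun i => ?_
  have h := veronese_add (A *ᵥ z) (A *ᵥ Pi.single i 1)
  rw [← mulVec_add, veronese_mulVec, veronese_mulVec, veronese_mulVec, veronese_add, mulVec_add,
    mulVec_add] at h
  rw [← mulVec_mulVec, ← mulVec_mulVec]
  exact add_left_cancel (add_right_cancel h)

/-- The field `T` in the coordinates given by the matrix `A`. -/
def conjField (A : Matrix (Fin 3) (Fin 3) S) (T : Matrix (Fin 3) (Fin 6) S) :
    Matrix (Fin 3) (Fin 6) S :=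
  A * T * symSquare A⁻¹

variable {A : Matrix (Fin 3) (Fin 3) S} (hA : IsUnit A.det)
include hA

theorem conjField_mulVec_veronese (T : Matrix (Fin 3) (Fin 6) S) (z : Fin 3 → S) :
    conjField A T *ᵥ veronese (A *ᵥ z) = A *ᵥ (T *ᵥ veronese z) := by
  rw [conjField, ← mulVec_mulVec, ← veronese_mulVec, mulVec_mulVec, nonsing_inv_mul _ hA,
    one_mulVec, mulVec_mulVec]

theorem conjField_mul_dVeronese (T : Matrix (Fin 3) (Fin 6) S) (z : Fin 3 → S) :
    conjField A T * dVeronese (A *ᵥ z) = A * (T * dVeronese z) * A⁻¹ := by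
  rw [conjField, Matrix.mul_assoc, symSquare_mul_dVeronese, mulVec_mulVec, nonsing_inv_mul _ hA,
    one_mulVec]
  simp only [Matrix.mul_assoc]

theorem exponentInvariants_conjField (T : Matrix (Fin 3) (Fin 6) S) (z : Fin 3 → S) :
    exponentInvariants (conjField A T) (A *ᵥ z) = exponentInvariants T z := by
  have hunit : IsUnit A := (isUnit_iff_isUnit_det A).2 hA
  have hsub : 1 - A * (T * dVeronese z) * A⁻¹ = A * (1 - T * dVeronese z) * A⁻¹ := by
    rw [Matrix.mul_sub, Matrix.sub_mul, Matrix.mul_one, mul_nonsing_inv _ hA]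
  rw [exponentInvariants, conjField_mul_dVeronese hA, hsub, det_conj hunit, trace_mul_cycle,
    nonsing_inv_mul _ hA, Matrix.one_mul, exponentInvariants]

end LinearChange

section Classes

variable {K : Type*} [Field K]

theorem IsSimpleFixedPoint.conjField {A : Matrix (Fin 3) (Fin 3) K} (hA : IsUnit A.det)
    {T : Matrix (Fin 3) (Fin 6) K} {a : Fin 3 → K} (ha : IsSimpleFixedPoint T a) :
    IsSimpleFixedPoint (QuadVF.conjField A T) (A *ᵥ a) := by
  refine ha.of_exponentInvariants_eq (fun h => ha.ne_zero ?_) ?_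
    (exponentInvariants_conjField hA T a)
  · exact mulVec_injective_of_isUnit ((isUnit_iff_isUnit_det A).2 hA) (h.trans (mulVec_zero A).symm)
  · rw [conjField_mulVec_veronese hA, ha.fixed]

theorem linearlyEquivalent_ofMatrix {A : Matrix (Fin 3) (Fin 3) ℂ} (hA : IsUnit A.det)
    (Y : QuadVF 3) :
    LinearlyEquivalent Y (ofMatrix (conjField A Y.coeffMatrix)) := by
  refine ⟨toLinearEquiv' A (invertibleOfIsUnitDet A hA), fun z => ?_⟩
  rw [value_eq, coeffMatrix_ofMatrix, value_eq]
  exact conjField_mulVec_veronese hA _ z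

theorem exists_matrix_mulVec_eq {m : Type*} [Fintype m] [DecidableEq m] {u v : m → m → K}
    (hu : (of u).det ≠ 0) (hv : (of v).det ≠ 0) :
    ∃ A : Matrix m m K, IsUnit A.det ∧ ∀ i, A *ᵥ u i = v i := by
  have hu' : IsUnit (of u)ᵀ.det := by rwa [det_transpose, isUnit_iff_ne_zero]
  have hv' : IsUnit (of v)ᵀ.det := by rwa [det_transpose, isUnit_iff_ne_zero]
  have hmul : (of v)ᵀ * (of u)ᵀ⁻¹ * (of u)ᵀ = (of v)ᵀ :=
    nonsing_inv_mul_cancel_right _ _ hu'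
  refine ⟨(of v)ᵀ * (of u)ᵀ⁻¹, ?_, fun i => _root_.funext fun j => congrFun (congrFun hmul j) i⟩
  rw [det_mul]
  exact hv'.mul (isUnit_nonsing_inv_det _ hu')

/-- The fields with six fixed points not on a conic that have the same exponents as those of `T` at
the points `q`, in coordinates in which the first three fixed points are the first three `q`. -/
def normalizedFields (T : Matrix (Fin 3) (Fin 6) ℂ) (q : Fin 6 → Fin 3 → ℂ) :
    Set (Matrix (Fin 3) (Fin 6) ℂ) :=
  {T' | ∃ y : Fin 6 → Fin 3 → ℂ, (veroneseMatrix y).det ≠ 0 ∧ (∀ k, T' *ᵥ veronese (y k) = y k) ∧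
    (∀ i, y (firstThree i) = q (firstThree i)) ∧
    ∀ k, exponentInvariants T' (y k) = exponentInvariants T (q k)}

theorem confEval_eq_of_mem_exponentData {T T' : Matrix (Fin 3) (Fin 6) ℂ}
    {q y : Fin 6 → Fin 3 → ℂ} (hq : (veroneseMatrix q).det ≠ 0) (hy : (veroneseMatrix y).det ≠ 0)
    (hT : ∀ k, T *ᵥ veronese (q k) = q k) (hT' : ∀ k, T' *ᵥ veronese (y k) = y k)
    (hthree : ∀ i, y (firstThree i) = q (firstThree i))
    (hinv : ∀ k, exponentInvariants T' (y k) = exponentInvariants T (q k)) :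
    ∀ a ∈ exponentData, confEval y hy a = confEval q hq a := by
  rintro _ (⟨⟨i, j⟩, rfl⟩ | ⟨k, rfl⟩ | ⟨i, rfl⟩)
  · calc confEval y hy (confPoint (firstThree i) j) = y (firstThree i) j :=
          congrFun (confEval_comp_confPoint hy _) j
      _ = q (firstThree i) j := congrFun (hthree i) j
      _ = confEval q hq (confPoint (firstThree i) j) :=
          (congrFun (confEval_comp_confPoint hq _) j).symm
  · exact (confEval_trace hy hT' k).trans
      ((congrArg Prod.fst (hinv k)).trans (confEval_trace hq hT k).symm)
  · exact (confEval_det hy hT' _).trans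
      ((congrArg Prod.snd (hinv _)).trans (confEval_det hq hT _).symm)

theorem genericallyMatrix_finite_normalizedFields :
    GenericallyMatrix fun T => ∀ q : Fin 6 → Fin 3 → ℂ, (veroneseMatrix q).det ≠ 0 →
      (∀ k, T *ᵥ veronese (q k) = q k) →
        (of fun i => q (firstThree i)).det ≠ 0 ∧ (normalizedFields T q).Finite := by
  obtain ⟨c, hc0, hc⟩ := exists_ne_zero_finite_configurations
  obtain ⟨F, hF0, hF⟩ := genericallyMatrix_confEval_ne_zero
    (mul_ne_zero hc0 det_confPoint_firstThree_ne_zero)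
  refine ⟨F, hF0, fun T hT q hq hTq => ?_⟩
  have hne := hF T hT q hq hTq
  rw [map_mul, mul_ne_zero_iff, AlgHom.map_det] at hne
  refine ⟨?_, ((hc (confEval q hq) hne.1).image interpolant).subset ?_⟩
  · simp only [← confEval_comp_confPoint hq]
    exact hne.2
  · rintro T' ⟨y, hy, hTy, hthree, hinv⟩
    exact ⟨y, ⟨confEval y hy, confEval_eq_of_mem_exponentData hq hy hTq hTy hthree hinv,
      confEval_comp_confPoint hy⟩,
      ((forall_mulVec_veronese_eq_iff (isUnit_iff_ne_zero.2 hy) T').1 hTy).symm⟩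

theorem exists_conjField_mem_normalizedFields {T T' : Matrix (Fin 3) (Fin 6) ℂ}
    {p y : Fin 7 → Fin 3 → ℂ} (hinj : Function.Injective y)
    (hy : ∀ k, IsSimpleFixedPoint T' (y k))
    (hinv : ∀ k, exponentInvariants T' (y k) = exponentInvariants T (p k))
    (hp : ∀ σ : Fin 6 ↪ Fin 7, (of fun i => p (σ (firstThree i))).det ≠ 0) :
    ∃ (A : Matrix (Fin 3) (Fin 3) ℂ) (σ : Fin 6 ↪ Fin 7),
      IsUnit A.det ∧ conjField A T' ∈ normalizedFields T (p ∘ σ) := by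
  obtain ⟨σ, hσ⟩ := exists_embedding_det_ne_zero hy hinj
  obtain ⟨A, hA, hAy⟩ := exists_matrix_mulVec_eq hσ (hp σ)
  have hfix : ∀ k, IsSimpleFixedPoint (conjField A T') (A *ᵥ y k) := fun k => (hy k).conjField hA
  have hAinj := mulVec_injective_of_isUnit ((isUnit_iff_isUnit_det A).2 hA)
  exact ⟨A, σ, hA, fun k => A *ᵥ y (σ k),
    det_veroneseMatrix_ne_zero hfix (hAinj.comp hinj) σ,
    fun k => (hfix (σ k)).fixed, hAy,
    fun k => (exponentInvariants_conjField hA T' _).trans (hinv (σ k))⟩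

theorem genericallyMatrix_finite_classes :
    GenericallyMatrix fun T => ∀ p : Fin 7 → Fin 3 → ℂ, Function.Injective p →
      (∀ k, IsSimpleFixedPoint T (p k)) → ∃ S : Set (QuadVF 3), S.Finite ∧
        ∀ (Y : QuadVF 3) (y : Fin 7 → Fin 3 → ℂ), Function.Injective y →
          (∀ k, IsSimpleFixedPoint Y.coeffMatrix (y k)) →
          (∀ k, exponentInvariants Y.coeffMatrix (y k) = exponentInvariants T (p k)) →
            ∃ Z ∈ S, LinearlyEquivalent Y Z := by
  obtain ⟨F, hF0, hF⟩ := genericallyMatrix_finite_normalizedFields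
  refine ⟨F, hF0, fun T hT p hinj hp => ?_⟩
  have hnorm := fun σ : Fin 6 ↪ Fin 7 => hF T hT (p ∘ σ) (det_veroneseMatrix_ne_zero hp hinj σ)
    fun k => (hp (σ k)).fixed
  refine ⟨ofMatrix '' ⋃ σ : Fin 6 ↪ Fin 7, normalizedFields T (p ∘ σ),
    (Set.finite_iUnion fun σ => (hnorm σ).2).image _, fun Y y hyinj hy hinv => ?_⟩
  obtain ⟨A, σ, hA, hmem⟩ := exists_conjField_mem_normalizedFields hyinj hy hinv
    fun σ => (hnorm σ).1
  exact ⟨_, Set.mem_image_of_mem _ (Set.mem_iUnion.2 ⟨σ, hmem⟩), linearlyEquivalent_ofMatrix hA Y⟩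

end Classes

theorem eq_mk_of_mem_submodule {K V : Type*} [Field K] [AddCommGroup V] [Module K V]
    {q : Projectivization K V} {a : V} (ha : a ≠ 0) (h : a ∈ q.submodule) :
    q = Projectivization.mk K a ha := by
  rw [Projectivization.submodule_eq] at h
  obtain ⟨c, hc⟩ := Submodule.mem_span_singleton.1 h
  conv_lhs => rw [← q.mk_rep]
  exact ((Projectivization.mk_eq_mk_iff' K a q.rep ha q.rep_nonzero).2 ⟨c, hc⟩).symm

section Orbits

variable {n : ℕ} {X : QuadVF n}

theorem RadialOrbit.point_spec (ρ : X.RadialOrbit) (hρ : ρ.IsNondegenerate) :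
    ρ.point hρ ∈ ρ.1.submodule ∧ ρ.point hρ ≠ 0 ∧ X.value (ρ.point hρ) = ρ.point hρ :=
  hρ.existsUnique.choose_spec.1

theorem RadialOrbit.point_eq {ρ : X.RadialOrbit} (hρ : ρ.IsNondegenerate) {a : Fin n → ℂ}
    (ha : a ≠ 0) (hfix : X.value a = a) (h : a ∈ ρ.1.submodule) : ρ.point hρ = a :=
  hρ.existsUnique.unique (ρ.point_spec hρ) ⟨h, ha, hfix⟩

theorem exists_radialOrbit_mem {a : Fin n → ℂ} (ha : a ≠ 0) (hfix : X.value a = a) :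
    ∃ ρ : X.RadialOrbit, a ∈ ρ.1.submodule := by
  have hmem : a ∈ (Projectivization.mk ℂ a ha).submodule := by
    rw [Projectivization.submodule_mk]
    exact Submodule.mem_span_singleton_self a
  refine ⟨⟨Projectivization.mk ℂ a ha, fun z hz => ?_⟩, hmem⟩
  rw [Projectivization.submodule_mk] at hz
  obtain ⟨c, rfl⟩ := Submodule.mem_span_singleton.1 hz
  rw [value_smul, hfix]
  exact Submodule.smul_mem _ _ hmem

/-- The radial orbits of a nondegenerate field correspond to its nonzero fixed points. -/
def orbitEquiv (hX : X.IsNondegenerate) :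
    X.RadialOrbit ≃ {a : Fin n → ℂ // a ≠ 0 ∧ X.value a = a} :=
  Equiv.ofBijective (fun ρ => ⟨ρ.point (hX ρ), (ρ.point_spec (hX ρ)).2⟩) <| by
    refine ⟨fun ρ ρ' h => ?_, fun ⟨a, ha, hfix⟩ => ?_⟩
    · have hpoint : ρ.point (hX ρ) = ρ'.point (hX ρ') := congrArg Subtype.val h
      have hmem := (ρ'.point_spec (hX ρ')).1
      rw [← hpoint] at hmem
      obtain ⟨hmem₀, hne, -⟩ := ρ.point_spec (hX ρ)
      exact Subtype.ext ((eq_mk_of_mem_submodule hne hmem₀).trans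
        (eq_mk_of_mem_submodule hne hmem).symm)
    · obtain ⟨ρ, hρ⟩ := exists_radialOrbit_mem ha hfix
      exact ⟨ρ, Subtype.ext (RadialOrbit.point_eq (hX ρ) ha hfix hρ)⟩

end Orbits

section ThreeDimensional

variable {X Y : QuadVF 3}

theorem isNondegenerate_of_forall (h : ∀ z, z ≠ 0 → X.coeffMatrix *ᵥ veronese z ≠ 0) :
    X.IsNondegenerate := fun _ z _ hz => value_eq X z ▸ h z hz

theorem card_radialOrbit (hX : X.IsNondegenerate) {p : Fin 7 → Fin 3 → ℂ}
    (hinj : Function.Injective p) (hp : ∀ k, IsSimpleFixedPoint X.coeffMatrix (p k)) :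
    Nat.card X.RadialOrbit = 7 := by
  let f : Fin 7 → {a : Fin 3 → ℂ // a ≠ 0 ∧ X.value a = a} := fun k =>
    ⟨p k, (hp k).ne_zero, (value_eq X _).trans (hp k).fixed⟩
  have hf : Function.Bijective f := by
    refine ⟨fun k l h => hinj (congrArg Subtype.val h), fun ⟨a, ha, hfix⟩ => ?_⟩
    rw [value_eq] at hfix
    obtain ⟨k, hk⟩ := exists_eq_of_mulVec_veronese_eq hp hinj ha hfix
    exact ⟨k, Subtype.ext hk⟩
  rw [Nat.card_congr (orbitEquiv hX), ← Nat.card_congr (Equiv.ofBijective f hf), Nat.card_fin]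

section Exponents

variable {ρ : X.RadialOrbit} (hρ : ρ.IsNondegenerate)

theorem jacobian_mulVec_point : X.jacobian (ρ.point hρ) *ᵥ ρ.point hρ = (2 : ℂ) • ρ.point hρ := by
  rw [jacobian_eq, ← mulVec_mulVec, dVeronese_self, mulVec_smul, ← value_eq,
    (ρ.point_spec hρ).2.2]

theorem charpoly_eq_prod_exponents :
    (1 - X.jacobian (ρ.point hρ)).charpoly = (Polynomial.X - Polynomial.C (-1)) *
      ((ρ.exponents hρ).map fun u => Polynomial.X - Polynomial.C u).prod := by
  set N := 1 - X.jacobian (ρ.point hρ) with hN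
  have hroot : N.charpoly.IsRoot (-1) := by
    rw [Polynomial.IsRoot, eval_charpoly, ← exists_mulVec_eq_zero_iff]
    refine ⟨ρ.point hρ, (ρ.point_spec hρ).2.1, ?_⟩
    rw [hN, sub_mulVec, sub_mulVec, jacobian_mulVec_point, one_mulVec, scalar_apply,
      ← smul_one_eq_diagonal, smul_mulVec, one_mulVec]
    module
  have hdiv := Polynomial.mul_divByMonic_eq_iff_isRoot.2 hroot
  have hmonic : (N.charpoly /ₘ (Polynomial.X - Polynomial.C (-1))).Monic :=
    (Polynomial.monic_X_sub_C (-1)).of_mul_monic_left (hdiv.symm ▸ N.charpoly_monic)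
  conv_lhs => rw [← hdiv, (IsAlgClosed.splits _).eq_prod_roots_of_monic hmonic]
  rfl

theorem exponentInvariants_eq_of_exponentPair_eq {ρ' : Y.RadialOrbit} (hρ' : ρ'.IsNondegenerate)
    (h : ρ.exponentPair hρ = ρ'.exponentPair hρ') :
    exponentInvariants X.coeffMatrix (ρ.point hρ) =
      exponentInvariants Y.coeffMatrix (ρ'.point hρ') := by
  have hchar : (1 - X.jacobian (ρ.point hρ)).charpoly =
      (1 - Y.jacobian (ρ'.point hρ')).charpoly := by
    rw [charpoly_eq_prod_exponents, charpoly_eq_prod_exponents,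
      show ρ.exponents hρ = ρ'.exponents hρ' from congrArg Subtype.val h]
  have htrace : (1 - X.jacobian (ρ.point hρ)).trace = (1 - Y.jacobian (ρ'.point hρ')).trace := by
    rw [trace_eq_neg_charpoly_coeff, trace_eq_neg_charpoly_coeff, hchar]
  have hdet : (1 - X.jacobian (ρ.point hρ)).det = (1 - Y.jacobian (ρ'.point hρ')).det := by
    rw [det_eq_sign_charpoly_coeff, det_eq_sign_charpoly_coeff, hchar]
  rw [trace_sub, trace_sub, sub_right_inj] at htrace
  rw [exponentInvariants, exponentInvariants, ← jacobian_eq, ← jacobian_eq, htrace, hdet]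

end Exponents

theorem exists_equiv_exponentPair_eq {e : Sym (Sym ℂ 2) 7} (hX : e ∈ Psi X) (hY : e ∈ Psi Y) :
    ∃ ε : X.RadialOrbit ≃ Y.RadialOrbit,
      ∀ ρ, (ε ρ).exponentPair (hY.1.1 (ε ρ)) = ρ.exponentPair (hX.1.1 ρ) := by
  obtain ⟨⟨_, hX7⟩, hXe⟩ := hX
  obtain ⟨⟨_, hY7⟩, hYe⟩ := hY
  have : Finite X.RadialOrbit := Nat.finite_of_card_ne_zero (by omega)
  have : Finite Y.RadialOrbit := Nat.finite_of_card_ne_zero (by omega)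
  let : Fintype X.RadialOrbit := Fintype.ofFinite _
  let : Fintype Y.RadialOrbit := Fintype.ofFinite _
  exact exists_equiv_of_map_univ_eq _ _ (congrArg Subtype.val (hXe.trans hYe.symm))

theorem exists_isSimpleFixedPoint_of_mem_Psi {e : Sym (Sym ℂ 2) 7} (hX : e ∈ Psi X)
    (hY : e ∈ Psi Y) {p : Fin 7 → Fin 3 → ℂ} (hinj : Function.Injective p)
    (hp : ∀ k, IsSimpleFixedPoint X.coeffMatrix (p k)) :
    ∃ y : Fin 7 → Fin 3 → ℂ, Function.Injective y ∧
      (∀ k, IsSimpleFixedPoint Y.coeffMatrix (y k)) ∧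
      ∀ k, exponentInvariants Y.coeffMatrix (y k) = exponentInvariants X.coeffMatrix (p k) := by
  have hXn := hX.1.1
  have hYn := hY.1.1
  obtain ⟨ε, hε⟩ := exists_equiv_exponentPair_eq hX hY
  let ρ : Fin 7 → X.RadialOrbit := fun k => (orbitEquiv hXn).symm
    ⟨p k, (hp k).ne_zero, (value_eq X _).trans (hp k).fixed⟩
  have hρ : ∀ k, (ρ k).point (hXn (ρ k)) = p k := fun k =>
    congrArg Subtype.val ((orbitEquiv hXn).apply_symm_apply _)
  have hinv : ∀ k, exponentInvariants Y.coeffMatrix ((ε (ρ k)).point (hYn _)) =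
      exponentInvariants X.coeffMatrix (p k) := fun k => by
    rw [← hρ k]
    exact exponentInvariants_eq_of_exponentPair_eq _ _ (hε (ρ k))
  refine ⟨fun k => (ε (ρ k)).point (hYn _), fun k l hkl => ?_, fun k => ?_, hinv⟩
  · have horbit : ε (ρ k) = ε (ρ l) := (orbitEquiv hYn).injective (Subtype.ext hkl)
    exact hinj (by rw [← hρ, ← hρ, ε.injective horbit])
  · obtain ⟨-, hne, hfix⟩ := (ε (ρ k)).point_spec (hYn _)
    exact (hp k).of_exponentInvariants_eq hne ((value_eq Y _).symm.trans hfix) (hinv k)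

end ThreeDimensional

end QuadVF

end

theorem theorem2p1 :
    QuadVF.Generically (n := 3) fun X =>
      ∃ e ∈ QuadVF.Psi X, ∃ S : Set (QuadVF 3), S.Finite ∧
        ∀ Y : QuadVF 3, e ∈ QuadVF.Psi Y → ∃ Z ∈ S, QuadVF.LinearlyEquivalent Y Z := by
  obtain ⟨F, hF0, hF⟩ := ((QuadVF.genericallyMatrix_mulVec_veronese_ne_zero.and
    QuadVF.genericallyMatrix_exists_isSimpleFixedPoint).and
    QuadVF.genericallyMatrix_finite_classes).generically
  refine ⟨F, hF0, fun X hX => ?_⟩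
  obtain ⟨⟨hne, p, hinj, hp⟩, hclasses⟩ := hF X hX
  have hn : X.IsNondegenerate := QuadVF.isNondegenerate_of_forall hne
  have h7 : Nat.card X.RadialOrbit = 7 := QuadVF.card_radialOrbit hn hinj hp
  have he : X.allExponents hn h7 ∈ QuadVF.Psi X := ⟨⟨hn, h7⟩, rfl⟩
  obtain ⟨S, hS, hSY⟩ := hclasses p hinj hp
  refine ⟨X.allExponents hn h7, he, S, hS, fun Y hY => ?_⟩
  obtain ⟨y, hyinj, hy, hinv⟩ := QuadVF.exists_isSimpleFixedPoint_of_mem_Psi he hY hinj hp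
  exact hSY Y y hyinj hy hinv
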